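/- Let $\mathbf{FI}$ be the category whose objects are the natural numbers $n\ge 0$ and whose morphisms $m\to n$ are the injections $[m]\hookrightarrow[n]$, where $[n]=\{1,\dots,n\}$. Let $V$ be an FI-module over $\mathbb{C}$, that is, a functor from $\mathbf{FI}$ to $\mathbb{C}$-vector spaces, $n\mapsto V_n$; each $V_n$ is a representation of $S_n$. The shift is $S_{+1}V=V\circ\Xi_1$, where $\Xi_1:\mathbf{FI}\to\mathbf{FI}$ sends $[n]$ to $[n]\sqcup\{0\}\cong[n+1]$ (the new point $0$ becomes $1$, and $i$ becomes $i+1$) and extends an injection by $0\mapsto 0$. * $V$ is *generated in degree $\le d$* if it is the smallest sub-FI-module of itself that contains some set of elements $v_j\in V_{n_j}$ with all $n_j\le d$; it is *finitely generated in degree $\le d$* if such a finite set exists, and *finitely generated* if some finite set of elements, in any degrees, generates it. * For a partition $\lambda$ and $n\ge|\lambda|+\lambda_1$ let $V(\lambda)_n$ be the irreducible representation of $S_n$ that corresponds to the partition $(n-|\lambda|,\lambda_1,\lambda_2,\dots)$ of $n$. $V$ has *weight $\le M$* if for every $n\ge0$ every irreducible constituent $V(\lambda)_n$ of $V_n$ satisfies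 $|\lambda|\le M$. * For $a\le n$ let $S_{n-a}\subseteq S_n$ be the subgroup that fixes $1,\dots,a$. $V$ has *stability degree $\le N$* if for all $a\ge 0$ and $n\ge N+a$ the map of coinvariants $(V_n)_{S_{n-a}}\to(V_{n+1})_{S_{(n+1)-a}}$ induced by the standard inclusion $[n]\hookrightarrow[n+1]$ is an isomorphism of $S_a$-modules. **Theorem.** For every FI-module $V$ over $\mathbb{C}$ and all natural numbers $d,M,N\ge 0$: 1. If $V$ is finitely generated and generated in degree $\le d$, then $S_{+1}V$ is finitely generated in degree $\le d$. Conversely, if $V_0$ is finite-dimensional and $S_{+1}V$ is finitely generated in degree $\le d$, then $V$ is finitely generated in degree $\le d+1$. 2. If $V$ is generated in degree $\le d$, then so is $S_{+1}V$. Conversely, if $S_{+1}V$ is generated in degree $\le d$, then $V$ is generated in degree $\le d+1$. 3. If $S_{+1}V$ has weight $\le M$, then $V$ has weight $\le M+1$. Conversely, if $V$ has weight $\le M$, then $S_{+1}V$ has weight $\le M$. 4. If $S_{+1}V$ has stability degree $\le N$, then $V$ has stability degree $\le N+1$. Conversely, if $V$ has stability degree $\le N$, then $S_{+1}V$ has stability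 degree $\le N$. -/

import Mathlib

open CategoryTheory

universe u

/-! ### The category FI and FI-modules over `ℂ` -/

/-- The category `FI`: its objects are the natural numbers `n`, standing for `[n] = Fin n`. -/
structure FI where
  /-- The number of elements of the finite set. -/
  card : ℕ

/-- Morphisms of `FI` are the injections. -/
instance : SmallCategory FI where
  Hom m n := Fin m.card ↪ Fin n.card
  id m := Function.Embedding.refl (Fin m.card)
  comp f g := Function.Embedding.trans f g

namespace FI

/-- An injection of finite sets, as a morphism of `FI`. -/
def ofEmb {m n : ℕ} (f : Fin m ↪ Fin n) : FI.mk m ⟶ FI.mk n := f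

/-- For an injection `f : [m] → [n]`, the injection `[m] ⊔ {*} → [n] ⊔ {*}` that fixes `*`.
The new point is put first: it is `0 : Fin (m + 1)`, and `i : Fin m` becomes `i.succ`. -/
def extendEmb {m n : ℕ} (f : Fin m ↪ Fin n) : Fin (m + 1) ↪ Fin (n + 1) where
  toFun := Fin.cases 0 (fun i => (f i).succ)
  inj' := by
    intro i j h
    induction i using Fin.cases with
    | zero =>
      induction j using Fin.cases with
      | zero => rfl
      | succ j => exact absurd h (Fin.succ_ne_zero _).symm
    | succ i =>
      induction j using Fin.cases with
      | zero => exact absurd h (Fin.succ_ne_zero _)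
      | succ j => exact congrArg Fin.succ (f.injective (Fin.succ_injective _ h))

/-- The functor `Ξ₁ : FI ⥤ FI`, `[n] ↦ [n] ⊔ {*}`. -/
def addPoint : FI ⥤ FI where
  obj n := FI.mk (n.card + 1)
  map f := ofEmb (extendEmb f)
  map_id _ := by
    refine Function.Embedding.ext fun i => ?_
    induction i using Fin.cases <;> rfl
  map_comp _ _ := by
    refine Function.Embedding.ext fun i => ?_
    induction i using Fin.cases <;> rfl

end FI

/-- An FI-module over `ℂ`: a functor from `FI` to complex vector spaces. -/
abbrev FIModule : Type (u + 1) := FI ⥤ ModuleCat.{u} ℂ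

namespace FIModule

variable (V : FIModule.{u})

/-- The vector space `V_n`. -/
abbrev at' (n : ℕ) : Type u := V.obj (FI.mk n)

/-- The linear map `V_m → V_n` induced by an injection `[m] → [n]`. -/
def mapEmb {m n : ℕ} (f : Fin m ↪ Fin n) : V.at' m →ₗ[ℂ] V.at' n :=
  (V.map (FI.ofEmb f)).hom

/-- The shift `S₊₁ V = V ∘ Ξ₁`. -/
def shift : FIModule.{u} := FI.addPoint ⋙ V

theorem mapEmb_refl (n : ℕ) : V.mapEmb (Function.Embedding.refl (Fin n)) = LinearMap.id :=
  congrArg ModuleCat.Hom.hom (V.map_id (FI.mk n))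

theorem mapEmb_trans {l m n : ℕ} (f : Fin l ↪ Fin m) (g : Fin m ↪ Fin n) :
    V.mapEmb (f.trans g) = V.mapEmb g ∘ₗ V.mapEmb f :=
  congrArg ModuleCat.Hom.hom (V.map_comp (FI.ofEmb f) (FI.ofEmb g))

/-! ### Generation -/

/-- A sub-FI-module of `V`. -/
structure SubFIModule where
  /-- The subspace of `V_n`. -/
  carrier : ∀ n : ℕ, Submodule ℂ (V.at' n)
  map_mem : ∀ {m n : ℕ} (f : Fin m ↪ Fin n) {v : V.at' m},
    v ∈ carrier m → V.mapEmb f v ∈ carrier n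

/-- The set `S` of elements of `⨆ V_n` generates `V`: the only sub-FI-module of `V` that
contains `S` is `V` itself. -/
def Generates (S : Set (Σ n : ℕ, V.at' n)) : Prop :=
  ∀ W : V.SubFIModule, (∀ x ∈ S, x.2 ∈ W.carrier x.1) → ∀ n, W.carrier n = ⊤

/-- `V` is generated in degree `≤ d`. -/
def GeneratedInDegreeLE (d : ℕ) : Prop :=
  ∃ S : Set (Σ n : ℕ, V.at' n), (∀ x ∈ S, x.1 ≤ d) ∧ V.Generates S

/-- `V` is finitely generated. -/
def FinitelyGenerated : Prop :=
  ∃ S : Set (Σ n : ℕ, V.at' n), S.Finite ∧ V.Generates S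

/-- `V` is finitely generated in degree `≤ d`. -/
def FinitelyGeneratedInDegreeLE (d : ℕ) : Prop :=
  ∃ S : Set (Σ n : ℕ, V.at' n), S.Finite ∧ (∀ x ∈ S, x.1 ≤ d) ∧ V.Generates S

/-! ### The representations `V_n` of the symmetric groups -/

/-- The action of `S_n` on `V_n`. -/
def rep (n : ℕ) : Representation ℂ (Equiv.Perm (Fin n)) (V.at' n) where
  toFun σ := V.mapEmb σ.toEmbedding
  map_one' := V.mapEmb_refl n
  map_mul' σ τ := V.mapEmb_trans τ.toEmbedding σ.toEmbedding

end FIModule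

/-! ### Partitions and the irreducible representations of `S_n` -/

/-- The partition `λ[n]`: a first row with `n - |λ|` boxes is put on top of the Young
diagram of `λ`. It is defined for `n ≥ |λ| + λ₁`. -/
def paddedDiagram (lam : YoungDiagram) (n : ℕ) (h : lam.card + lam.rowLen 0 ≤ n) :
    YoungDiagram where
  cells := (Finset.range (n - lam.card)).image (fun j => ((0 : ℕ), j)) ∪
    lam.cells.image (fun c => (c.1 + 1, c.2))
  isLowerSet := by
    rintro ⟨i, j⟩ ⟨i', j'⟩ ⟨hi, hj⟩ hc
    simp only [Finset.coe_union, Finset.coe_image, Finset.coe_range, Set.mem_union,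
      Set.mem_image, Set.mem_Iio, Prod.mk.injEq, Finset.mem_coe, Prod.exists] at hc ⊢
    simp only at hi hj
    rcases hc with ⟨b, hb, h1, h2⟩ | ⟨a, b, hab, h1, h2⟩
    · exact Or.inl ⟨j', by omega, by omega, rfl⟩
    · subst h1 h2
      cases i' with
      | zero =>
        refine Or.inl ⟨j', ?_, rfl, rfl⟩
        have h3 : (0, b) ∈ lam := lam.up_left_mem (Nat.zero_le a) le_rfl hab
        have h4 := YoungDiagram.mem_iff_lt_rowLen.1 h3
        omega
      | succ i' =>
        exact Or.inr ⟨i', j', lam.up_left_mem (by omega) hj hab, rfl, rfl⟩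

section Young

open scoped MonoidAlgebra

variable {n : ℕ} {mu : YoungDiagram}

open scoped Classical in
/-- The Young symmetrizer `c_T = (∑ p) * (∑ sgn(q) q)` of a tableau `T` of shape `mu`
(a numbering of the boxes of `mu`): here `p` runs over the permutations that preserve each row
of `T`, and `q` over those that preserve each column. The box `(i, j)` lies in row `i` and in
column `j`. -/
noncomputable def youngSymmetrizer (T : Fin n ≃ mu.cells) : ℂ[Equiv.Perm (Fin n)] :=
  (∑ p : Equiv.Perm (Fin n) with ∀ k, (T (p k)).1.1 = (T k).1.1,
      MonoidAlgebra.single p (1 : ℂ)) *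
    ∑ q : Equiv.Perm (Fin n) with ∀ k, (T (q k)).1.2 = (T k).1.2,
      MonoidAlgebra.single q ((Equiv.Perm.sign q : ℤ) : ℂ)

/-- The left ideal `ℂ[S_n] c_T`, a subspace of `ℂ[S_n]`. -/
noncomputable def youngIdeal (T : Fin n ≃ mu.cells) : Submodule ℂ ℂ[Equiv.Perm (Fin n)] :=
  LinearMap.range (LinearMap.mulRight ℂ (youngSymmetrizer T))

/-- The irreducible representation `V_mu` of `S_n` that belongs to the partition `mu` of `n`:
the group `S_n` acts on the left ideal `ℂ[S_n] c_T` by left multiplication. Up to isomorphism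
it does not depend on the tableau `T` of shape `mu`. -/
noncomputable def youngRep (T : Fin n ≃ mu.cells) :
    Representation ℂ (Equiv.Perm (Fin n)) (youngIdeal T) where
  toFun g := (LinearMap.mulLeft ℂ (MonoidAlgebra.single g (1 : ℂ))).restrict (by
    rintro _ ⟨y, rfl⟩
    exact ⟨MonoidAlgebra.single g 1 * y, by simp [mul_assoc]⟩)
  map_one' := by
    ext x : 2
    simp [← MonoidAlgebra.one_def]
  map_mul' g h := by
    ext x : 2
    simp [← mul_assoc, MonoidAlgebra.single_mul_single]

end Young

/-- `V_mu` is an irreducible constituent of the representation `ρ` of `S_n`, where `mu` is a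
partition of `n` (`S_n`-representations over `ℂ` are semisimple, so that constituents are
subrepresentations). -/
def IsConstituent {n : ℕ} {E : Type*} [AddCommGroup E] [Module ℂ E]
    (mu : YoungDiagram) (ρ : Representation ℂ (Equiv.Perm (Fin n)) E) : Prop :=
  ∃ (T : Fin n ≃ mu.cells) (f : (youngRep T).IntertwiningMap ρ), Function.Injective f

/-- `V` has weight `≤ d`: for all `n`, every irreducible constituent `V(λ)_n = V_{λ[n]}` of `V_n`
has `|λ| ≤ d`. -/
def FIModule.HasWeightLE (V : FIModule.{u}) (d : ℕ) : Prop :=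
  ∀ (n : ℕ) (lam : YoungDiagram) (h : lam.card + lam.rowLen 0 ≤ n),
    IsConstituent (paddedDiagram lam n h) (V.rep n) → lam.card ≤ d

/-! ### Coinvariants and stability degree -/

/-- The subgroup `S_{n-a}` of `S_n` that fixes each of the first `a` points. -/
def fixFirst (a n : ℕ) : Subgroup (Equiv.Perm (Fin n)) where
  carrier := {σ | ∀ i : Fin n, i.val < a → σ i = i}
  one_mem' _ _ := rfl
  mul_mem' {σ τ} hσ hτ i hi := by rw [Equiv.Perm.mul_apply, hτ i hi, hσ i hi]
  inv_mem' {σ} hσ i hi := by rw [Equiv.Perm.inv_eq_iff_eq, hσ i hi]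

/-- The inclusion `S_a → S_n`, for `a ≤ n`: permutations of the first `a` points. -/
noncomputable def permFirst {a n : ℕ} (h : a ≤ n) :
    Equiv.Perm (Fin a) →* Equiv.Perm (Fin n) :=
  Equiv.Perm.viaEmbeddingHom (Fin.castLEEmb h)

theorem permFirst_castLE {a n : ℕ} (h : a ≤ n) (σ : Equiv.Perm (Fin a)) (i : Fin a) :
    permFirst h σ (Fin.castLE h i) = Fin.castLE h (σ i) :=
  Equiv.Perm.viaEmbedding_apply σ (Fin.castLEEmb h) i

theorem permFirst_of_le {a n : ℕ} (h : a ≤ n) (σ : Equiv.Perm (Fin a)) (i : Fin n)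
    (hi : a ≤ i.val) : permFirst h σ i = i := by
  refine Equiv.Perm.viaEmbedding_apply_of_notMem σ (Fin.castLEEmb h) i ?_
  rintro ⟨j, rfl⟩
  exact absurd j.2 (not_lt.2 hi)

theorem permFirst_commute {a n : ℕ} (h : a ≤ n) (σ : Equiv.Perm (Fin a))
    (τ : fixFirst a n) : permFirst h σ * τ.1 = τ.1 * permFirst h σ := by
  refine (Equiv.Perm.Disjoint.commute fun i => ?_).eq
  rcases lt_or_ge i.val a with hi | hi
  · exact Or.inr (τ.2 i hi)
  · exact Or.inl (permFirst_of_le h σ i hi)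

/-- The permutation of `[n + 1]` that extends a permutation of `[n]` and fixes the last point. -/
noncomputable def permCastSucc {n : ℕ} : Equiv.Perm (Fin n) →* Equiv.Perm (Fin (n + 1)) :=
  Equiv.Perm.viaEmbeddingHom Fin.castSuccEmb

theorem permCastSucc_castSucc {n : ℕ} (σ : Equiv.Perm (Fin n)) (i : Fin n) :
    permCastSucc σ i.castSucc = (σ i).castSucc :=
  Equiv.Perm.viaEmbedding_apply σ Fin.castSuccEmb i

theorem permCastSucc_mem {a n : ℕ} {σ : Equiv.Perm (Fin n)} (hσ : σ ∈ fixFirst a n) :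
    permCastSucc σ ∈ fixFirst a (n + 1) := by
  intro i hi
  induction i using Fin.lastCases with
  | last =>
    refine Equiv.Perm.viaEmbedding_apply_of_notMem σ Fin.castSuccEmb _ ?_
    rintro ⟨j, hj⟩
    exact (Fin.castSucc_lt_last j).ne hj
  | cast i => rw [permCastSucc_castSucc, hσ i hi]

namespace FIModule

variable (V : FIModule.{u})

/-- The representation of `S_{n-a}` on `V_n`. -/
def repFix (a n : ℕ) : Representation ℂ (fixFirst a n) (V.at' n) :=
  (V.rep n).comp (fixFirst a n).subtype

/-- The coinvariant quotient `(V_n)_{S_{n-a}}`. -/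
abbrev Coinv (a n : ℕ) : Type u := (V.repFix a n).Coinvariants

/-- The action of `S_a` on `(V_n)_{S_{n-a}}`, for `a ≤ n`. -/
noncomputable def coinvRep {a n : ℕ} (h : a ≤ n) :
    Representation ℂ (Equiv.Perm (Fin a)) (V.Coinv a n) where
  toFun σ := Representation.Coinvariants.lift (V.repFix a n)
    (Representation.Coinvariants.mk (V.repFix a n) ∘ₗ V.rep n (permFirst h σ)) (by
      intro τ
      ext v
      have h1 : V.rep n (permFirst h σ) (V.repFix a n τ v) =
          V.repFix a n τ (V.rep n (permFirst h σ) v) := by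
        change (V.rep n (permFirst h σ) * V.rep n τ.1) v =
          (V.rep n τ.1 * V.rep n (permFirst h σ)) v
        rw [← map_mul, ← map_mul, permFirst_commute]
      simp only [LinearMap.comp_apply, h1, Representation.Coinvariants.mk_self_apply])
  map_one' := by
    ext v
    simp
  map_mul' σ τ := by
    ext v
    simp

theorem mapEmb_castSucc_rep {n : ℕ} (σ : Equiv.Perm (Fin n)) (τ : Equiv.Perm (Fin (n + 1)))
    (h : ∀ i : Fin n, (σ i).castSucc = τ i.castSucc) (v : V.at' n) :
    V.mapEmb Fin.castSuccEmb (V.rep n σ v) = V.rep (n + 1) τ (V.mapEmb Fin.castSuccEmb v) := by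
  change (V.mapEmb Fin.castSuccEmb ∘ₗ V.mapEmb σ.toEmbedding) v =
    (V.mapEmb τ.toEmbedding ∘ₗ V.mapEmb Fin.castSuccEmb) v
  rw [← mapEmb_trans, ← mapEmb_trans]
  congr 2
  exact Function.Embedding.ext h

/-- The map of `S_a`-modules `(V_n)_{S_{n-a}} → (V_{n+1})_{S_{(n+1)-a}}` that is induced by the
standard inclusion `[n] → [n + 1]`. -/
noncomputable def coinvMap {a n : ℕ} (h : a ≤ n) :
    (V.coinvRep h).IntertwiningMap (V.coinvRep (h.trans n.le_succ)) where
  toLinearMap := Representation.Coinvariants.lift (V.repFix a n)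
    (Representation.Coinvariants.mk (V.repFix a (n + 1)) ∘ₗ V.mapEmb Fin.castSuccEmb) (by
      intro τ
      ext v
      have h1 : V.mapEmb Fin.castSuccEmb (V.repFix a n τ v) =
          V.repFix a (n + 1) ⟨permCastSucc τ.1, permCastSucc_mem τ.2⟩
            (V.mapEmb Fin.castSuccEmb v) :=
        V.mapEmb_castSucc_rep _ _ (fun i => (permCastSucc_castSucc τ.1 i).symm) v
      simp only [LinearMap.comp_apply, h1, Representation.Coinvariants.mk_self_apply])
  isIntertwining' σ := by
    ext v
    refine congrArg (Representation.Coinvariants.mk (V.repFix a (n + 1)))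
      (V.mapEmb_castSucc_rep (permFirst h σ) (permFirst (h.trans n.le_succ) σ) (fun i => ?_) v)
    rcases lt_or_ge i.val a with hi | hi
    · obtain ⟨j, rfl⟩ : ∃ j : Fin a, i = Fin.castLE h j := ⟨⟨i.val, hi⟩, rfl⟩
      have h2 : (Fin.castLE h j).castSucc = Fin.castLE (h.trans n.le_succ) j := rfl
      rw [h2, permFirst_castLE, permFirst_castLE]
      rfl
    · rw [permFirst_of_le h σ i hi, permFirst_of_le _ σ i.castSucc hi]

/-- `V` has stability degree `≤ N`: for all `a` and all `n ≥ N + a`, the induced map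
`(V_n)_{S_{n-a}} → (V_{n+1})_{S_{(n+1)-a}}` is an isomorphism of `S_a`-modules. -/
def HasStabilityDegreeLE (N : ℕ) : Prop :=
  ∀ (a n : ℕ) (h : N + a ≤ n),
    Function.Bijective (V.coinvMap ((Nat.le_add_left a N).trans h))

end FIModule

/-!
Degree of generation: the image of a generator `v ∈ V_k` under an injection `[k] → [n] ⊔ {0}` is
the image of an element of some `V_{m+1}` with `m ≤ k`, under a morphism of the shift. The images
of `v` in these finitely many spaces therefore generate what `v` contributes to `S₊₁ V`.
Conversely, generators of the shift together with generators of `V_0` generate `V`.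

Stability degree: the coinvariants of `(S₊₁ V)_n` under `S_{n-a}` are those of `V_{n+1}` under
`S_{(n+1)-(a+1)}`, so that stability of the shift at `a` is stability of `V` at `a + 1`. This
leaves `a = 0` for `V`. Surjectivity passes from `a = 1` to the quotient. For injectivity let `x` be
a coinvariant that is killed by the stabilization map. The transfer `∑ i, (0 i)` from `S_{n+1}`- to
`S_n`-coinvariants commutes with stabilization up to the map `ι` induced by an injection that avoids
`0`. Hence stabilization sends the transfer of `x` to `-ι x`, and, applied once more, to `0`. By
injectivity at `a = 1` the transfer of `x` vanishes, and with it `(n + 1) x`.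

Weight: by means of Young symmetrizers, the irreducible constituents of `V_n` whose diagram has a
first row of length `< k` are those contained in the subspace of the vectors killed by the
symmetrizers `∑ σ` of all sets of `k` points. Hence `V` has weight `≤ M` if and only if, for
`k = n - M` and all `n`, no nonzero vector of `V_n` is killed by all these symmetrizers. For the
shift one uses the sets of points of `[n] ⊔ {0}` that avoid `0`, and each set of `k + 1` points
contains `k` points other than `0`.
-/

/-! ### Generation -/

namespace FIModule

variable {V : FIModule.{u}}

theorem mapEmb_mapEmb {l m n : ℕ} (f : Fin l ↪ Fin m) (g : Fin m ↪ Fin n) (v : V.at' l) :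
    V.mapEmb g (V.mapEmb f v) = V.mapEmb (f.trans g) v :=
  (LinearMap.congr_fun (V.mapEmb_trans f g) v).symm

theorem shift_mapEmb {m n : ℕ} (f : Fin m ↪ Fin n) (v : V.at' (m + 1)) :
    V.shift.mapEmb (m := m) (n := n) f v = V.mapEmb (FI.extendEmb f) v :=
  rfl

namespace SubFIModule

/-- The sub-FI-module generated by a set of elements of `V`: in degree `n` it is spanned by their
images under all injections into `[n]`. -/
def span (S : Set (Σ n : ℕ, V.at' n)) : V.SubFIModule where
  carrier n := Submodule.span ℂ {v | ∃ x ∈ S, ∃ f : Fin x.1 ↪ Fin n, V.mapEmb f x.2 = v}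
  map_mem {m n} f v hv := by
    refine (Submodule.span_le (p := Submodule.comap (V.mapEmb f) (Submodule.span ℂ _))).2 ?_ hv
    rintro _ ⟨x, hx, g, rfl⟩
    exact Submodule.subset_span ⟨x, hx, g.trans f, (mapEmb_mapEmb g f x.2).symm⟩

theorem mem_span_of_mem {S : Set (Σ n : ℕ, V.at' n)} {x : Σ n : ℕ, V.at' n} (hx : x ∈ S) :
    x.2 ∈ (span S).carrier x.1 :=
  Submodule.subset_span ⟨x, hx, .refl _, LinearMap.congr_fun (V.mapEmb_refl x.1) x.2⟩

theorem span_carrier_le {S : Set (Σ n : ℕ, V.at' n)} {W : V.SubFIModule}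
    (h : ∀ x ∈ S, x.2 ∈ W.carrier x.1) (n : ℕ) : (span S).carrier n ≤ W.carrier n := by
  refine Submodule.span_le.2 ?_
  rintro _ ⟨x, hx, f, rfl⟩
  exact W.map_mem f (h x hx)

theorem exists_finite_mem_span {S : Set (Σ n : ℕ, V.at' n)} {n : ℕ} {v : V.at' n}
    (hv : v ∈ (span S).carrier n) : ∃ F ⊆ S, F.Finite ∧ v ∈ (span F).carrier n := by
  obtain ⟨t, hts, hvt⟩ := Submodule.mem_span_finite_of_mem_span hv
  have h : ∀ w : t, ∃ x ∈ S, ∃ f : Fin x.1 ↪ Fin n, V.mapEmb f x.2 = w := fun w => hts w.2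
  choose x hx f hf using h
  refine ⟨Set.range x, Set.range_subset_iff.2 hx, Set.finite_range x, ?_⟩
  refine Submodule.span_mono ?_ hvt
  exact fun w hw => ⟨x ⟨w, hw⟩, ⟨_, rfl⟩, f ⟨w, hw⟩, hf ⟨w, hw⟩⟩

end SubFIModule

theorem generates_iff_span_eq_top {S : Set (Σ n : ℕ, V.at' n)} :
    V.Generates S ↔ ∀ n, (SubFIModule.span S).carrier n = ⊤ :=
  ⟨fun h => h _ fun _ hx => SubFIModule.mem_span_of_mem hx,
    fun h _ hW n => top_le_iff.1 (h n ▸ SubFIModule.span_carrier_le hW n)⟩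

theorem FinitelyGenerated.finitelyGeneratedInDegreeLE {d : ℕ} (h : V.FinitelyGenerated)
    (hd : V.GeneratedInDegreeLE d) : V.FinitelyGeneratedInDegreeLE d := by
  obtain ⟨S, hS, hSgen⟩ := h
  obtain ⟨R, hRd, hRgen⟩ := hd
  have hR (x : Σ n : ℕ, V.at' n) : x.2 ∈ (SubFIModule.span R).carrier x.1 := by
    rw [generates_iff_span_eq_top.1 hRgen]
    exact Submodule.mem_top
  choose F hFR hF hxF using fun x => SubFIModule.exists_finite_mem_span (hR x)
  refine ⟨⋃ x ∈ S, F x, hS.biUnion fun x _ => hF x, fun y hy => ?_, fun W hW => ?_⟩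
  · obtain ⟨x, -, hyx⟩ := Set.mem_iUnion₂.1 hy
    exact hRd y (hFR x hyx)
  · refine hSgen W fun x hx => SubFIModule.span_carrier_le (fun y hy => ?_) x.1 (hxF x)
    exact hW y (Set.mem_biUnion hx hy)

theorem exists_eq_trans_extendEmb {k n : ℕ} (f : Fin k ↪ Fin (n + 1)) :
    ∃ m ≤ k, ∃ (g : Fin k ↪ Fin (m + 1)) (h : Fin m ↪ Fin n), f = g.trans (FI.extendEmb h) := by
  classical
  let s : Finset (Fin n) := {i | i.succ ∈ Finset.univ.map f}
  let h : Fin s.card ↪ Fin n := (s.orderEmbOfFin rfl).toEmbedding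
  have hs : s.card ≤ k := by
    rw [← s.card_map (Fin.succEmb n), ← Finset.card_fin k, ← Finset.card_map f]
    refine Finset.card_le_card fun j hj => ?_
    obtain ⟨i, hi, rfl⟩ := Finset.mem_map.1 hj
    exact (Finset.mem_filter.1 hi).2
  have hf (i : Fin k) : ∃ j, FI.extendEmb h j = f i := by
    rcases Fin.eq_zero_or_eq_succ (f i) with hi | ⟨l, hl⟩
    · exact ⟨0, hi.symm⟩
    · have hls : l ∈ Set.range (s.orderEmbOfFin rfl) := by
        rw [Finset.range_orderEmbOfFin]
        exact Finset.mem_filter.2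
          ⟨Finset.mem_univ l, Finset.mem_map.2 ⟨i, Finset.mem_univ i, hl⟩⟩
      obtain ⟨j, hj⟩ := hls
      exact ⟨j.succ, (congrArg Fin.succ hj).trans hl.symm⟩
  choose g hg using hf
  refine ⟨s.card, hs, ⟨g, fun i j hij => f.injective ?_⟩, h, ?_⟩
  · rw [← hg i, ← hg j, hij]
  · exact Function.Embedding.ext fun i => (hg i).symm

/-- The images of an element of `V_k` in the spaces `(S₊₁ V)_m = V_{m+1}` with `m ≤ k`: they
generate all its images in the shift. -/
def shiftGens (x : Σ n : ℕ, V.at' n) : Set (Σ n : ℕ, V.shift.at' n) :=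
  ⋃ m ∈ Set.Iic x.1, Set.range fun f : Fin x.1 ↪ Fin (m + 1) => ⟨m, V.mapEmb f x.2⟩

theorem finite_shiftGens (x : Σ n : ℕ, V.at' n) : (shiftGens x).Finite :=
  (Set.finite_Iic x.1).biUnion fun _ _ => Set.finite_range _

theorem degree_le_of_mem_shiftGens {x : Σ n : ℕ, V.at' n} {y : Σ n : ℕ, V.shift.at' n}
    (h : y ∈ shiftGens x) : y.1 ≤ x.1 := by
  obtain ⟨m, hm, f, rfl⟩ := Set.mem_iUnion₂.1 h
  exact hm

theorem mapEmb_mem_of_shiftGens {W : V.shift.SubFIModule} {x : Σ n : ℕ, V.at' n}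
    (hW : ∀ y ∈ shiftGens x, y.2 ∈ W.carrier y.1) {n : ℕ} (f : Fin x.1 ↪ Fin (n + 1)) :
    (V.mapEmb f x.2 : V.shift.at' n) ∈ W.carrier n := by
  obtain ⟨m, hm, g, h, rfl⟩ := exists_eq_trans_extendEmb f
  rw [← mapEmb_mapEmb, ← shift_mapEmb]
  exact W.map_mem h (hW ⟨m, V.mapEmb g x.2⟩ (Set.mem_biUnion hm ⟨g, rfl⟩))

theorem Generates.shift {S : Set (Σ n : ℕ, V.at' n)} (hS : V.Generates S) :
    V.shift.Generates (⋃ x ∈ S, shiftGens x) := by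
  intro W hW n
  have hspan : (SubFIModule.span S).carrier (n + 1) ≤ W.carrier n := by
    refine Submodule.span_le.2 ?_
    rintro _ ⟨x, hx, f, rfl⟩
    exact mapEmb_mem_of_shiftGens (fun y hy => hW y (Set.mem_biUnion hx hy)) f
  rw [generates_iff_span_eq_top.1 hS] at hspan
  exact top_le_iff.1 hspan

theorem degree_le_of_mem_biUnion_shiftGens {S : Set (Σ n : ℕ, V.at' n)} {d : ℕ}
    (hd : ∀ x ∈ S, x.1 ≤ d) : ∀ y ∈ ⋃ x ∈ S, shiftGens x, y.1 ≤ d := by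
  intro y hy
  obtain ⟨x, hxS, hyx⟩ := Set.mem_iUnion₂.1 hy
  exact (degree_le_of_mem_shiftGens hyx).trans (hd x hxS)

theorem GeneratedInDegreeLE.shift {d : ℕ} (h : V.GeneratedInDegreeLE d) :
    V.shift.GeneratedInDegreeLE d := by
  obtain ⟨S, hd, hgen⟩ := h
  exact ⟨_, degree_le_of_mem_biUnion_shiftGens hd, hgen.shift⟩

theorem FinitelyGeneratedInDegreeLE.shift {d : ℕ} (h : V.FinitelyGeneratedInDegreeLE d) :
    V.shift.FinitelyGeneratedInDegreeLE d := by
  obtain ⟨S, hS, hd, hgen⟩ := h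
  exact ⟨_, hS.biUnion fun x _ => finite_shiftGens x, degree_le_of_mem_biUnion_shiftGens hd,
    hgen.shift⟩

/-- A sub-FI-module of `V`, seen in the shift. -/
def SubFIModule.shift (W : V.SubFIModule) : V.shift.SubFIModule where
  carrier n := W.carrier (n + 1)
  map_mem f _ hv := W.map_mem (FI.extendEmb f) hv

/-- An element of `(S₊₁ V)_n`, as an element of `V_{n+1}`. -/
def unshift (x : Σ n : ℕ, V.shift.at' n) : Σ n : ℕ, V.at' n :=
  ⟨x.1 + 1, x.2⟩

theorem Generates.of_shift {S : Set (Σ n : ℕ, V.shift.at' n)} (hS : V.shift.Generates S)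
    {B : Set (V.at' 0)} (hB : Submodule.span ℂ B = ⊤) :
    V.Generates (unshift '' S ∪ Sigma.mk 0 '' B) := by
  intro W hW n
  cases n with
  | zero =>
    rw [eq_top_iff, ← hB, Submodule.span_le]
    exact fun v hv => hW ⟨0, v⟩ (Or.inr ⟨v, hv, rfl⟩)
  | succ n => exact hS W.shift (fun x hx => hW _ (Or.inl ⟨x, hx, rfl⟩)) n

theorem degree_le_of_mem_unshift_union {S : Set (Σ n : ℕ, V.shift.at' n)} {d : ℕ}
    (hd : ∀ x ∈ S, x.1 ≤ d) (B : Set (V.at' 0)) :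
    ∀ y ∈ unshift '' S ∪ Sigma.mk 0 '' B, y.1 ≤ d + 1 := by
  rintro _ (⟨x, hx, rfl⟩ | ⟨v, -, rfl⟩)
  · exact Nat.succ_le_succ (hd x hx)
  · exact Nat.zero_le _

theorem GeneratedInDegreeLE.of_shift {d : ℕ} (h : V.shift.GeneratedInDegreeLE d) :
    V.GeneratedInDegreeLE (d + 1) := by
  obtain ⟨S, hd, hgen⟩ := h
  exact ⟨_, degree_le_of_mem_unshift_union hd _, hgen.of_shift Submodule.span_univ⟩

theorem FinitelyGeneratedInDegreeLE.of_shift {d : ℕ} [hV : Module.Finite ℂ (V.at' 0)]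
    (h : V.shift.FinitelyGeneratedInDegreeLE d) : V.FinitelyGeneratedInDegreeLE (d + 1) := by
  obtain ⟨S, hS, hd, hgen⟩ := h
  obtain ⟨B, hB⟩ := hV.fg_top
  exact ⟨_, (hS.image _).union (B.finite_toSet.image _), degree_le_of_mem_unshift_union hd _,
    hgen.of_shift hB⟩

end FIModule

/-! ### Permutations of `[n] ⊔ {0}` -/

/-- The inclusion of `S_n` into `S_{n+1}` as the stabilizer of `0`: these are the permutations by
which `S_n` acts on the shift. -/
def permSucc {n : ℕ} : Equiv.Perm (Fin n) →* Equiv.Perm (Fin (n + 1)) where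
  toFun σ := Equiv.Perm.decomposeFin.symm (0, σ)
  map_one' := Equiv.Perm.decomposeFin_symm_of_one 0 |>.trans (Equiv.swap_self 0)
  map_mul' σ τ := by
    refine Equiv.ext fun i => ?_
    induction i using Fin.cases <;> simp

@[simp]
theorem permSucc_zero {n : ℕ} (σ : Equiv.Perm (Fin n)) : permSucc σ 0 = 0 :=
  Equiv.Perm.decomposeFin_symm_apply_zero 0 σ

@[simp]
theorem permSucc_succ {n : ℕ} (σ : Equiv.Perm (Fin n)) (i : Fin n) :
    permSucc σ i.succ = (σ i).succ := by
  simp [permSucc]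

theorem permSucc_injective (n : ℕ) : Function.Injective (permSucc (n := n)) := fun _ _ h =>
  (Prod.mk_right_injective 0) (Equiv.Perm.decomposeFin.symm.injective h)

theorem exists_permSucc_eq {n : ℕ} {τ : Equiv.Perm (Fin (n + 1))} (h : τ 0 = 0) :
    ∃ σ, permSucc σ = τ := by
  obtain ⟨⟨i, σ⟩, rfl⟩ := Equiv.Perm.decomposeFin.symm.surjective τ
  obtain rfl : i = 0 := by rwa [Equiv.Perm.decomposeFin_symm_apply_zero] at h
  exact ⟨σ, rfl⟩

theorem extendEmb_toEmbedding {n : ℕ} (σ : Equiv.Perm (Fin n)) :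
    FI.extendEmb σ.toEmbedding = (permSucc σ).toEmbedding := by
  refine Function.Embedding.ext fun i => ?_
  induction i using Fin.cases with
  | zero => exact (permSucc_zero σ).symm
  | succ i => exact (permSucc_succ σ i).symm

theorem extendEmb_castSuccEmb (n : ℕ) :
    FI.extendEmb (Fin.castSuccEmb : Fin n ↪ Fin (n + 1)) = Fin.castSuccEmb := by
  refine Function.Embedding.ext fun i => ?_
  induction i using Fin.cases <;> rfl

theorem map_permSucc_fixFirst (a n : ℕ) :
    (fixFirst a n).map permSucc = fixFirst (a + 1) (n + 1) := by
  refine SetLike.ext fun τ => Subgroup.mem_map.trans ⟨?_, fun hτ => ?_⟩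
  · rintro ⟨σ, hσ, rfl⟩ i hi
    induction i using Fin.cases with
    | zero => exact permSucc_zero σ
    | succ i => rw [permSucc_succ, hσ i (Nat.lt_of_succ_lt_succ hi)]
  · obtain ⟨σ, rfl⟩ := exists_permSucc_eq (hτ 0 a.succ_pos)
    refine ⟨σ, fun i hi => Fin.succ_injective _ ?_, rfl⟩
    rw [← permSucc_succ, hτ i.succ (Nat.succ_lt_succ hi)]

theorem exists_mem_fixFirst_trans_eq {a m n : ℕ} {f g : Fin m ↪ Fin n}
    (h : ∀ i, (f i).val < a ∨ (g i).val < a → f i = g i) :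
    ∃ τ ∈ fixFirst a n, g.trans τ.toEmbedding = f := by
  let φ : Fin n → Fin n := Function.extend g f id
  have hφg (i : Fin m) : φ (g i) = f i := g.injective.extend_apply f id i
  have hφ (j : Fin n) (hj : j.val < a) : φ j = j := by
    by_cases hjg : ∃ i, g i = j
    · obtain ⟨i, rfl⟩ := hjg
      rw [hφg, h i (.inr hj)]
    · exact Function.extend_apply' f id j hjg
  have hinj : Set.InjOn φ ({j | j.val < a} ∪ Set.range g) := by
    rintro x (hx | ⟨i, rfl⟩) y (hy | ⟨j, rfl⟩) hxy
    · rwa [hφ x hx, hφ y hy] at hxy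
    · rw [hφ x hx, hφg] at hxy
      rw [hxy, h j (.inl (hxy ▸ hx))]
    · rw [hφ y hy, hφg] at hxy
      rw [← hxy, h i (.inl (hxy ▸ hy))]
    · rw [hφg, hφg] at hxy
      rw [f.injective hxy]
  obtain ⟨τ, hτ⟩ := Equiv.Perm.exists_extending_pair _ _ Subtype.val_injective hinj.injective
  refine ⟨τ, fun j hj => (hτ ⟨j, .inl hj⟩).trans (hφ j hj), Function.Embedding.ext fun i => ?_⟩
  exact (hτ ⟨g i, .inr ⟨i, rfl⟩⟩).trans (hφg i)

/-! ### Coinvariants and stability degree -/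

theorem coinvariantsKer_mono {k G H E : Type*} [CommRing k] [Group G] [Group H] [AddCommGroup E]
    [Module k E] {ρ : Representation k G E} {τ : Representation k H E}
    (h : Set.range ρ ⊆ Set.range τ) :
    Representation.Coinvariants.ker ρ ≤ Representation.Coinvariants.ker τ := by
  refine Submodule.span_le.2 ?_
  rintro _ ⟨⟨g, v⟩, rfl⟩
  obtain ⟨g', hg⟩ := h ⟨g, rfl⟩
  simp only [← hg]
  exact Representation.Coinvariants.sub_mem_ker g' v

namespace FIModule

open Representation

variable {V : FIModule.{u}}

theorem shift_rep {n : ℕ} (σ : Equiv.Perm (Fin n)) :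
    V.shift.rep n σ = V.rep (n + 1) (permSucc σ) :=
  congrArg V.mapEmb (extendEmb_toEmbedding σ)

theorem range_repFix (a n : ℕ) : Set.range (V.repFix a n) = V.rep n '' fixFirst a n := by
  rw [Set.image_eq_range]
  rfl

theorem range_shift_repFix (a n : ℕ) :
    Set.range (V.shift.repFix a n) = Set.range (V.repFix (a + 1) (n + 1)) := by
  rw [range_repFix, range_repFix, ← map_permSucc_fixFirst, Subgroup.coe_map, Set.image_image]
  exact Set.image_congr fun σ _ => shift_rep σ

variable (V) in
/-- The identification `((S₊₁ V)_n)_{S_{n-a}} = (V_{n+1})_{S_{(n+1)-(a+1)}}`. -/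
noncomputable def shiftCoinvEquiv (a n : ℕ) :
    V.shift.Coinv a n ≃ₗ[ℂ] V.Coinv (a + 1) (n + 1) :=
  Submodule.quotEquivOfEq _ _ <| le_antisymm
    (coinvariantsKer_mono (range_shift_repFix a n).subset)
    (coinvariantsKer_mono (range_shift_repFix a n).superset)

theorem coinvMap_mk {a n : ℕ} (h : a ≤ n) (v : V.at' n) :
    V.coinvMap h (Coinvariants.mk _ v) = Coinvariants.mk _ (V.mapEmb Fin.castSuccEmb v) :=
  rfl

theorem shiftCoinvEquiv_coinvMap {a n : ℕ} (h : a ≤ n) (x : V.shift.Coinv a n) :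
    V.shiftCoinvEquiv a (n + 1) (V.shift.coinvMap h x) =
      V.coinvMap (Nat.succ_le_succ h) (V.shiftCoinvEquiv a n x) := by
  induction x using Coinvariants.induction_on with | h v
  exact congrArg (Coinvariants.mk _)
    (LinearMap.congr_fun (congrArg V.mapEmb (extendEmb_castSuccEmb n)) v)

theorem bijective_shift_coinvMap_iff {a n : ℕ} (h : a ≤ n) :
    Function.Bijective (V.shift.coinvMap h) ↔
      Function.Bijective (V.coinvMap (Nat.succ_le_succ h)) := by
  rw [← (V.shiftCoinvEquiv a (n + 1)).bijective.of_comp_iff',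
    ← (V.shiftCoinvEquiv a n).bijective.of_comp_iff]
  exact iff_of_eq (congrArg _ (funext (shiftCoinvEquiv_coinvMap h)))

theorem mk_mapEmb_eq_mk_mapEmb {a m n : ℕ} {f g : Fin m ↪ Fin n}
    (h : ∀ i, (f i).val < a ∨ (g i).val < a → f i = g i) (v : V.at' m) :
    Coinvariants.mk (V.repFix a n) (V.mapEmb f v) =
      Coinvariants.mk (V.repFix a n) (V.mapEmb g v) := by
  obtain ⟨τ, hτ, rfl⟩ := exists_mem_fixFirst_trans_eq h
  rw [← mapEmb_mapEmb]
  exact Coinvariants.mk_self_apply (V.repFix a n) ⟨τ, hτ⟩ (V.mapEmb g v)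

theorem mk_mapEmb_eq_of_apply_eq_zero_iff {m n : ℕ} {f g : Fin m ↪ Fin (n + 1)}
    (h : ∀ i, f i = 0 ↔ g i = 0) (v : V.at' m) :
    Coinvariants.mk (V.repFix 1 (n + 1)) (V.mapEmb f v) =
      Coinvariants.mk (V.repFix 1 (n + 1)) (V.mapEmb g v) := by
  refine mk_mapEmb_eq_mk_mapEmb (fun i hi => ?_) v
  simp only [Nat.lt_one_iff, Fin.val_eq_zero_iff, h i, or_self] at hi
  rw [(h i).2 hi, hi]

variable (V) in
/-- The projection `(V_n)_{S_{n-b}} → (V_n)_{S_{n-a}}` for `a ≤ b`. -/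
noncomputable def coinvProj {a b : ℕ} (h : a ≤ b) (n : ℕ) : V.Coinv b n →ₗ[ℂ] V.Coinv a n :=
  Coinvariants.lift (V.repFix b n) (Coinvariants.mk (V.repFix a n)) fun g =>
    LinearMap.ext (Coinvariants.mk_self_apply (V.repFix a n) ⟨g, fun i hi => g.2 i (hi.trans_le h)⟩)

theorem coinvProj_mk {a b : ℕ} (h : a ≤ b) {n : ℕ} (v : V.at' n) :
    V.coinvProj h n (Coinvariants.mk _ v) = Coinvariants.mk _ v :=
  rfl

theorem surjective_coinvProj {a b : ℕ} (h : a ≤ b) (n : ℕ) :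
    Function.Surjective (V.coinvProj h n) := fun x => by
  induction x using Coinvariants.induction_on with | h v
  exact ⟨Coinvariants.mk _ v, coinvProj_mk h v⟩

theorem coinvProj_coinvMap {a b n : ℕ} (h : a ≤ b) (hb : b ≤ n) (x : V.Coinv b n) :
    V.coinvProj h (n + 1) (V.coinvMap hb x) = V.coinvMap (h.trans hb) (V.coinvProj h n x) := by
  induction x using Coinvariants.induction_on with | h v
  rfl

theorem surjective_coinvMap_of_le {a b n : ℕ} (h : a ≤ b) (hb : b ≤ n)
    (hsurj : Function.Surjective (V.coinvMap hb)) :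
    Function.Surjective (V.coinvMap (h.trans hb)) := by
  have hcomp : V.coinvMap (h.trans hb) ∘ V.coinvProj h n = V.coinvProj h (n + 1) ∘ V.coinvMap hb :=
    funext fun x => (coinvProj_coinvMap h hb x).symm
  refine Function.Surjective.of_comp (g := V.coinvProj h n) ?_
  rw [hcomp]
  exact (surjective_coinvProj h (n + 1)).comp hsurj

variable (V) in
/-- The transfer `(V_{n+1})_{S_{n+1}} → (V_{n+1})_{S_n}`: the sum over the coset representatives
`(0 i)` of `S_n` in `S_{n+1}`. -/
noncomputable def transfer (n : ℕ) : V.Coinv 0 (n + 1) →ₗ[ℂ] V.Coinv 1 (n + 1) :=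
  Coinvariants.lift (V.repFix 0 (n + 1))
    (∑ i, Coinvariants.mk (V.repFix 1 (n + 1)) ∘ₗ V.rep (n + 1) (Equiv.swap 0 i)) fun ⟨σ, _⟩ => by
      ext v
      simp only [LinearMap.comp_apply, LinearMap.sum_apply]
      rw [← Equiv.sum_comp σ]
      refine Finset.sum_congr rfl fun i _ => ?_
      refine (congrArg _ (mapEmb_mapEmb σ.toEmbedding _ v)).trans
        (mk_mapEmb_eq_of_apply_eq_zero_iff (fun j => ?_) v)
      change Equiv.swap 0 (σ i) (σ j) = 0 ↔ Equiv.swap 0 i j = 0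
      simp only [Equiv.swap_apply_eq_iff, Equiv.swap_apply_left, σ.apply_eq_iff_eq]

theorem transfer_mk {n : ℕ} (v : V.at' (n + 1)) :
    V.transfer n (Coinvariants.mk _ v) =
      ∑ i, Coinvariants.mk _ (V.rep (n + 1) (Equiv.swap 0 i) v) :=
  LinearMap.sum_apply ..

theorem coinvProj_transfer {n : ℕ} (x : V.Coinv 0 (n + 1)) :
    V.coinvProj zero_le_one (n + 1) (V.transfer n x) = (n + 1) • x := by
  induction x using Coinvariants.induction_on with | h v
  have hswap (i : Fin (n + 1)) : Coinvariants.mk (V.repFix 0 (n + 1))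
      (V.rep (n + 1) (Equiv.swap 0 i) v) = Coinvariants.mk _ v :=
    Coinvariants.mk_self_apply (V.repFix 0 (n + 1))
      ⟨Equiv.swap 0 i, fun j hj => absurd hj j.val.not_lt_zero⟩ v
  simp only [transfer_mk, map_sum, coinvProj_mk, hswap, Finset.sum_const, Finset.card_univ,
    Fintype.card_fin]

theorem injective_transfer (n : ℕ) : Function.Injective (V.transfer n) := by
  rw [injective_iff_map_eq_zero]
  intro x hx
  have h := coinvProj_transfer x
  rw [hx, map_zero, eq_comm, ← Nat.cast_smul_eq_nsmul ℂ] at h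
  exact (smul_eq_zero.1 h).resolve_left (Nat.cast_ne_zero.2 n.succ_ne_zero)

variable (V) in
/-- The map `(V_n)_{S_n} → (V_{n+1})_{S_n}` induced by any injection `[n] → [n + 1]` that avoids
the point `0`, here `i ↦ i + 1`. -/
noncomputable def avoidZero (n : ℕ) : V.Coinv 0 n →ₗ[ℂ] V.Coinv 1 (n + 1) :=
  Coinvariants.lift (V.repFix 0 n)
    (Coinvariants.mk (V.repFix 1 (n + 1)) ∘ₗ V.mapEmb (Fin.succEmb n)) fun ⟨σ, _⟩ => by
      ext v
      refine (congrArg _ (mapEmb_mapEmb σ.toEmbedding _ v)).trans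
        (mk_mapEmb_eq_of_apply_eq_zero_iff (fun i => ?_) v)
      exact iff_of_false (Fin.succ_ne_zero (σ i)) (Fin.succ_ne_zero i)

theorem avoidZero_mk {n : ℕ} (v : V.at' n) :
    V.avoidZero n (Coinvariants.mk _ v) = Coinvariants.mk _ (V.mapEmb (Fin.succEmb n) v) :=
  rfl

theorem coinvMap_avoidZero {n : ℕ} (x : V.Coinv 0 n) :
    V.coinvMap (Nat.succ_le_succ n.zero_le) (V.avoidZero n x) =
      V.avoidZero (n + 1) (V.coinvMap n.zero_le x) := by
  induction x using Coinvariants.induction_on with | h v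
  simp only [avoidZero_mk, coinvMap_mk, mapEmb_mapEmb]
  rfl

theorem transfer_coinvMap {n : ℕ} (x : V.Coinv 0 (n + 1)) :
    V.transfer (n + 1) (V.coinvMap (n + 1).zero_le x) =
      V.coinvMap (Nat.succ_le_succ n.zero_le) (V.transfer n x) + V.avoidZero (n + 1) x := by
  induction x using Coinvariants.induction_on with | h v
  rw [coinvMap_mk, transfer_mk, transfer_mk, avoidZero_mk, map_sum, Fin.sum_univ_castSucc]
  congr 1
  · refine Finset.sum_congr rfl fun i _ => ?_
    rw [coinvMap_mk, V.mapEmb_castSucc_rep (Equiv.swap 0 i) (Equiv.swap 0 i.castSucc)]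
    intro j
    exact (Fin.castSucc_injective _).swap_apply 0 i j |>.symm
  · refine (congrArg _ (mapEmb_mapEmb _ _ v)).trans
      (mk_mapEmb_eq_of_apply_eq_zero_iff (fun i => iff_of_false ?_ (Fin.succ_ne_zero i)) v)
    change Equiv.swap 0 (Fin.last (n + 1)) i.castSucc ≠ 0
    rw [Ne, Equiv.swap_apply_eq_iff, Equiv.swap_apply_left]
    exact (Fin.castSucc_lt_last i).ne

theorem injective_coinvMap_zero {n : ℕ}
    (h₁ : Function.Injective (V.coinvMap (Nat.succ_le_succ n.zero_le)))
    (h₂ : Function.Injective (V.coinvMap (Nat.succ_le_succ (n + 1).zero_le))) :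
    Function.Injective (V.coinvMap (n + 1).zero_le) := by
  refine (injective_iff_map_eq_zero (V.coinvMap (n + 1).zero_le)).2 fun x hx => ?_
  have htransfer := transfer_coinvMap x
  rw [hx, map_zero] at htransfer
  have hsq : V.coinvMap (Nat.succ_le_succ (n + 1).zero_le)
      (V.coinvMap (Nat.succ_le_succ n.zero_le) (V.transfer n x)) = 0 := by
    have h := congrArg (V.coinvMap (Nat.succ_le_succ (n + 1).zero_le)) htransfer
    rwa [map_zero, map_add, coinvMap_avoidZero, hx, map_zero, add_zero, eq_comm] at h
  refine injective_transfer n (h₁ (h₂ ?_))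
  rw [hsq, map_zero, map_zero, map_zero]

theorem HasStabilityDegreeLE.shift {N : ℕ} (h : V.HasStabilityDegreeLE N) :
    V.shift.HasStabilityDegreeLE N := fun a n han =>
  (bijective_shift_coinvMap_iff _).2 (h (a + 1) (n + 1) (Nat.succ_le_succ han))

theorem HasStabilityDegreeLE.of_shift {N : ℕ} (h : V.shift.HasStabilityDegreeLE N) :
    V.HasStabilityDegreeLE (N + 1) := by
  have hsucc (a n : ℕ) (han : N + a ≤ n) : Function.Bijective
      (V.coinvMap (Nat.succ_le_succ ((Nat.le_add_left a N).trans han))) :=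
    (bijective_shift_coinvMap_iff _).1 (h a n han)
  rintro (_ | a) (_ | n) han
  · omega
  · exact ⟨injective_coinvMap_zero (hsucc 0 n (by omega)).1 (hsucc 0 (n + 1) (by omega)).1,
      surjective_coinvMap_of_le zero_le_one _ (hsucc 0 n (by omega)).2⟩
  · omega
  · exact hsucc a n (by omega)

end FIModule

/-! ### Group algebras -/

section GroupAlgebra

open scoped MonoidAlgebra

theorem eq_zero_of_forall_mul_mul_eq_zero {R : Type*} [Ring R] [IsSemisimpleRing R] {x : R}
    (h : ∀ y, x * y * x = 0) : x = 0 := by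
  obtain ⟨e, he, hspan⟩ := IsSemisimpleRing.ideal_eq_span_idempotent (Ideal.span {x})
  obtain ⟨a, rfl⟩ := Ideal.mem_span_singleton'.1 (hspan ▸ Ideal.mem_span_singleton_self e)
  obtain ⟨b, hb⟩ := Ideal.mem_span_singleton'.1 (hspan ▸ Ideal.mem_span_singleton_self x)
  calc x = b * (a * x * (a * x)) := by rw [he.eq, hb]
    _ = b * a * (x * a * x) := by simp only [mul_assoc]
    _ = 0 := by rw [h, mul_zero]

theorem mul_self_ne_zero_of_mem_center {k A : Type*} [CommSemiring k] [Ring A] [Algebra k A]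
    [IsSemisimpleRing A] {z : A} (hz : z ∈ Subalgebra.center k A) (h0 : z ≠ 0) : z * z ≠ 0 :=
  fun h => h0 <| eq_zero_of_forall_mul_mul_eq_zero fun y => by
    rw [← Subalgebra.mem_center_iff.1 hz y, mul_assoc, h, mul_zero]

theorem linearIndependent_of_mul_eq_zero {ι k A : Type*} [Field k] [Ring A] [Algebra k A]
    {z : ι → A} (h0 : Pairwise fun i j => z i * z j = 0) (h1 : ∀ i, z i * z i ≠ 0) :
    LinearIndependent k z := by
  classical
  rw [linearIndependent_iff']
  intro s a hs i hi
  have h := congrArg (· * z i) hs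
  simp only [Finset.sum_mul, smul_mul_assoc, zero_mul] at h
  rw [Finset.sum_eq_single_of_mem i hi (fun j _ hj => by rw [h0 hj, smul_zero])] at h
  exact (smul_eq_zero_iff_left (h1 i)).1 h

variable {k G : Type*} [Field k] [Group G]

/-- If `c k[G] c` is spanned by `c` and `c u ≠ 0`, then the orbit map of `u` embeds the left ideal
generated by `c`. -/
theorem eq_zero_of_asAlgebraHom_eq_zero [IsSemisimpleRing k[G]] {E : Type*} [AddCommGroup E]
    [Module k E] {ρ : Representation k G E} {c : k[G]} (h : ∀ x, ∃ s : k, c * x * c = s • c) {u : E}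
    (hu : ρ.asAlgebraHom c u ≠ 0) {x : k[G]} (hx : ρ.asAlgebraHom (x * c) u = 0) :
    x * c = 0 := by
  refine eq_zero_of_forall_mul_mul_eq_zero fun y => ?_
  obtain ⟨s, hs⟩ := h (y * x)
  have hsu : ρ.asAlgebraHom (c * (y * x) * c) u = 0 := by
    rw [show c * (y * x) * c = c * y * (x * c) by simp only [mul_assoc], map_mul,
      Module.End.mul_apply, hx, map_zero]
  rw [hs, map_smul, LinearMap.smul_apply, smul_eq_zero_iff_left hu] at hsu
  calc x * c * y * (x * c) = x * (c * (y * x) * c) := by simp only [mul_assoc]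
    _ = 0 := by rw [hs, hsu, zero_smul, mul_zero]

theorem asAlgebraHom_intertwiningMap_apply {E F : Type*} [AddCommGroup E] [Module k E]
    [AddCommGroup F] [Module k F] {ρ : Representation k G E} {τ : Representation k G F}
    (f : τ.IntertwiningMap ρ) (x : k[G]) (y : F) :
    ρ.asAlgebraHom x (f y) = f (τ.asAlgebraHom x y) := by
  induction x using MonoidAlgebra.induction_linear with
  | zero => simp
  | add x x' hx hx' => simp [hx, hx']
  | single g a => simp [f.isIntertwining]

theorem coeff_eq_of_isConj {x : k[G]} (hx : x ∈ Subalgebra.center k k[G]) {g h : G}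
    (hgh : IsConj g h) : x.coeff g = x.coeff h := by
  obtain ⟨a, rfl⟩ := isConj_iff.1 hgh
  have := congrArg (fun w => w.coeff (a * g))
    (Subalgebra.mem_center_iff.1 hx (MonoidAlgebra.single a 1))
  simpa [MonoidAlgebra.coeff_mul_single_apply, MonoidAlgebra.coeff_single_mul_apply] using this

theorem finrank_center_monoidAlgebra_le [Finite G] :
    Module.finrank k (Subalgebra.center k k[G]) ≤ Nat.card (ConjClasses G) := by
  have := Fintype.ofFinite (ConjClasses G)
  let Φ : Subalgebra.center k k[G] →ₗ[k] ConjClasses G → k :=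
    { toFun := fun x C => x.1.coeff C.out
      map_add' := fun _ _ => rfl
      map_smul' := fun _ _ => rfl }
  have hΦ : Function.Injective Φ := by
    refine fun x y hxy => Subtype.ext (MonoidAlgebra.ext (Finsupp.ext fun g => ?_))
    have hg : IsConj (ConjClasses.mk g).out g :=
      ConjClasses.mk_eq_mk_iff_isConj.1 (Quotient.out_eq _)
    rw [← coeff_eq_of_isConj x.2 hg, ← coeff_eq_of_isConj y.2 hg]
    exact congrFun hxy (ConjClasses.mk g)
  rw [Nat.card_eq_fintype_card, ← Module.finrank_fintype_fun_eq_card k]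
  exact LinearMap.finrank_le_finrank_of_injective hΦ

theorem one_mem_span_range_of_mem_center [Finite G] {z : ConjClasses G → k[G]}
    (hz : ∀ C, z C ∈ Subalgebra.center k k[G]) (hli : LinearIndependent k z) :
    1 ∈ Submodule.span k (Set.range z) := by
  have := Fintype.ofFinite (ConjClasses G)
  have hle : Submodule.span k (Set.range z) ≤ Subalgebra.toSubmodule (Subalgebra.center k k[G]) :=
    Submodule.span_le.2 (Set.range_subset_iff.2 hz)
  have hrank : Module.finrank k (Subalgebra.toSubmodule (Subalgebra.center k k[G])) ≤
      Module.finrank k (Submodule.span k (Set.range z)) := by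
    rw [finrank_span_eq_card hli, ← Nat.card_eq_fintype_card]
    exact finrank_center_monoidAlgebra_le
  rw [Submodule.eq_of_le_of_finrank_le hle hrank]
  exact one_mem (Subalgebra.center k k[G])

theorem mul_mul_mem_of_forall_single {W : Submodule k k[G]} {a b : k[G]}
    (h : ∀ g, a * MonoidAlgebra.single g 1 * b ∈ W) (x : k[G]) : a * x * b ∈ W := by
  induction x using MonoidAlgebra.induction_linear with
  | zero => rw [mul_zero, zero_mul]; exact W.zero_mem
  | add x y hx hy => rw [mul_add, add_mul]; exact W.add_mem hx hy
  | single g s =>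
    rw [← mul_one s, ← MonoidAlgebra.smul_single', mul_smul_comm, smul_mul_assoc]
    exact W.smul_mem s (h g)

variable [Fintype G]

/-- The sum of the conjugates of an element of the group algebra: a way to produce central
elements. -/
noncomputable def conjSum (c : k[G]) : k[G] :=
  ∑ g, MonoidAlgebra.single g 1 * c * MonoidAlgebra.single g⁻¹ 1

theorem conjSum_mem_center (c : k[G]) : conjSum c ∈ Subalgebra.center k k[G] := by
  refine Subalgebra.mem_center_iff.2 fun x => ?_
  induction x using MonoidAlgebra.induction_linear with
  | zero => rw [mul_zero, zero_mul]
  | add x y hx hy => rw [mul_add, add_mul, hx, hy]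
  | single h a =>
    rw [conjSum, Finset.mul_sum, Finset.sum_mul]
    refine Fintype.sum_equiv (Equiv.mulLeft h) _ _ fun g => ?_
    have smul_one (g' : G) : MonoidAlgebra.single g' a = a • MonoidAlgebra.single g' 1 := by
      rw [MonoidAlgebra.smul_single', mul_one]
    rw [Equiv.coe_mulLeft, ← mul_assoc, ← mul_assoc, MonoidAlgebra.single_mul_single, mul_assoc _ _
      (MonoidAlgebra.single h a), MonoidAlgebra.single_mul_single, mul_inv_rev,
      inv_mul_cancel_right, one_mul, mul_one, smul_one, smul_one]
    simp only [smul_mul_assoc, mul_smul_comm]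

theorem coeff_conjSum_one (c : k[G]) : (conjSum c).coeff 1 = Nat.card G * c.coeff 1 := by
  rw [conjSum, MonoidAlgebra.coeff_sum, Finsupp.finsetSum_apply]
  simp [MonoidAlgebra.coeff_mul_single_apply, MonoidAlgebra.coeff_single_mul_apply]

theorem conjSum_ne_zero [CharZero k] {c : k[G]} (h : c.coeff 1 ≠ 0) : conjSum c ≠ 0 := by
  intro h0
  have h1 := coeff_conjSum_one c
  rw [h0, MonoidAlgebra.coeff_zero, Finsupp.zero_apply, eq_comm, mul_eq_zero] at h1
  exact h1.elim (Nat.cast_ne_zero.2 Nat.card_pos.ne') h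

theorem conjSum_mul_conjSum_eq_zero {c d : k[G]} (h : ∀ x, c * x * d = 0) :
    conjSum c * conjSum d = 0 := by
  rw [conjSum, conjSum, Finset.sum_mul_sum]
  refine Finset.sum_eq_zero fun g _ => Finset.sum_eq_zero fun g' _ => ?_
  calc _ = MonoidAlgebra.single g 1 *
        (c * (MonoidAlgebra.single g⁻¹ 1 * MonoidAlgebra.single g' 1) * d) *
        MonoidAlgebra.single g'⁻¹ 1 := by simp only [mul_assoc]
    _ = 0 := by rw [h, mul_zero, zero_mul]

theorem exists_of_asAlgebraHom_conjSum_ne_zero {E : Type*} [AddCommGroup E] [Module k E]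
    {ρ : Representation k G E} {c : k[G]} {u : E} (h : ρ.asAlgebraHom (conjSum c) u ≠ 0) :
    ∃ g, ρ.asAlgebraHom c (ρ g u) ≠ 0 := by
  by_contra! h0
  refine h ?_
  rw [conjSum, map_sum, LinearMap.sum_apply]
  refine Finset.sum_eq_zero fun g _ => ?_
  rw [map_mul, map_mul, Module.End.mul_apply, Module.End.mul_apply,
    Representation.asAlgebraHom_single_one ρ g⁻¹, h0, map_zero]

open scoped Classical in
/-- The element `∑ χ(g) g` of the group algebra, where `g` runs over a subgroup. For the trivial
character and for the sign of a permutation group it is the symmetrizer and the antisymmetrizer. -/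
noncomputable def charSum (χ : G →* k) (H : Subgroup G) : k[G] :=
  ∑ g with g ∈ H, MonoidAlgebra.single g (χ g)

section CharSum

variable {χ ψ : G →* k} {H K : Subgroup G}

theorem charSum_bot : charSum χ ⊥ = 1 := by
  classical
  rw [charSum, Finset.sum_eq_single_of_mem 1 (by simp), map_one, MonoidAlgebra.one_def]
  exact fun g hg hg1 => absurd (Subgroup.mem_bot.1 (Finset.mem_filter.1 hg).2) hg1

open scoped Classical in
theorem coeff_charSum (g : G) : (charSum χ H).coeff g = if g ∈ H then χ g else 0 := by
  rw [charSum, MonoidAlgebra.coeff_sum, Finsupp.finsetSum_apply]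
  simp [MonoidAlgebra.coeff_single, Finsupp.single_apply]

theorem single_mul_charSum {h : G} (hh : h ∈ H) :
    MonoidAlgebra.single h (χ h) * charSum χ H = charSum χ H := by
  classical
  rw [charSum, Finset.mul_sum]
  refine Finset.sum_equiv (Equiv.mulLeft h) (fun g => ?_) fun g _ => ?_
  · simp only [Finset.mem_filter, Finset.mem_univ, true_and, Equiv.coe_mulLeft,
      H.mul_mem_cancel_left hh]
  · rw [MonoidAlgebra.single_mul_single, Equiv.coe_mulLeft, map_mul]

theorem charSum_mul_single {h : G} (hh : h ∈ H) :
    charSum χ H * MonoidAlgebra.single h (χ h) = charSum χ H := by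
  classical
  rw [charSum, Finset.sum_mul]
  refine Finset.sum_equiv (Equiv.mulRight h) (fun g => ?_) fun g _ => ?_
  · simp only [Finset.mem_filter, Finset.mem_univ, true_and, Equiv.coe_mulRight,
      H.mul_mem_cancel_right hh]
  · rw [MonoidAlgebra.single_mul_single, Equiv.coe_mulRight, map_mul]

theorem single_one_mul_charSum {h : G} (hh : h ∈ H) :
    MonoidAlgebra.single h 1 * charSum χ H = χ h⁻¹ • charSum χ H := by
  conv_rhs => rw [← single_mul_charSum hh, ← smul_mul_assoc, MonoidAlgebra.smul_single', ← map_mul,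
    inv_mul_cancel, map_one]

theorem charSum_mul_single_one {h : G} (hh : h ∈ H) :
    charSum χ H * MonoidAlgebra.single h 1 = χ h⁻¹ • charSum χ H := by
  conv_rhs => rw [← charSum_mul_single hh, ← mul_smul_comm, MonoidAlgebra.smul_single', ← map_mul,
    inv_mul_cancel, map_one]

theorem charSum_mul_charSum_of_le (h : H ≤ K) :
    charSum χ H * charSum χ K = Nat.card H • charSum χ K := by
  classical
  rw [charSum, Finset.sum_mul, Finset.sum_congr rfl fun g hg =>
    single_mul_charSum (h (Finset.mem_filter.1 hg).2), Finset.sum_const, Nat.card_eq_fintype_card,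
    Fintype.card_subtype]

theorem charSum_mul_charSum_of_ge (h : K ≤ H) :
    charSum χ H * charSum χ K = Nat.card K • charSum χ H := by
  classical
  rw [charSum, charSum, Finset.mul_sum, ← charSum, Finset.sum_congr rfl fun g hg =>
    charSum_mul_single (h (Finset.mem_filter.1 hg).2), Finset.sum_const, Nat.card_eq_fintype_card,
    Fintype.card_subtype]

theorem single_mul_charSum_eq_charSum_map_conj_mul_single (g : G) :
    MonoidAlgebra.single g 1 * charSum χ H =
      charSum χ (H.map (MulAut.conj g).toMonoidHom) * MonoidAlgebra.single g 1 := by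
  classical
  rw [charSum, charSum, Finset.mul_sum, Finset.sum_mul]
  refine Finset.sum_equiv (MulAut.conj g).toEquiv (fun h => ?_) fun h _ => ?_
  · simp
  · have hχ : χ (g * h * g⁻¹) = χ h := by
      rw [map_mul, map_mul, mul_right_comm, ← map_mul, mul_inv_cancel, map_one, one_mul]
    simp [MonoidAlgebra.single_mul_single, hχ]

theorem coeff_charSum_mul_charSum_one (h : Disjoint H K) :
    (charSum χ H * charSum ψ K).coeff 1 = 1 := by
  classical
  rw [charSum, Finset.sum_mul, MonoidAlgebra.coeff_sum, Finsupp.finsetSum_apply,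
    Finset.sum_eq_single_of_mem 1 (by simp [H.one_mem])]
  · simp [MonoidAlgebra.coeff_single_mul_apply, coeff_charSum, K.one_mem]
  · intro g hg hg1
    have hgK : g ∉ K := fun hgK =>
      hg1 (Subgroup.disjoint_def.1 h (Finset.mem_filter.1 hg).2 hgK)
    simp [MonoidAlgebra.coeff_single_mul_apply, coeff_charSum, hgK]

theorem charSum_mul_single_mul_charSum_eq_zero {g t : G} (hH : t ∈ H) (hK : g⁻¹ * t * g ∈ K)
    (ht : χ t ≠ ψ (g⁻¹ * t * g)) :
    charSum χ H * MonoidAlgebra.single g 1 * charSum ψ K = 0 := by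
  have hcomm : MonoidAlgebra.single t⁻¹ (1 : k) * MonoidAlgebra.single g 1 =
      MonoidAlgebra.single g 1 * MonoidAlgebra.single (g⁻¹ * t * g)⁻¹ 1 := by
    simp only [MonoidAlgebra.single_mul_single]
    congr 1
    group
  have h : χ t • (charSum χ H * MonoidAlgebra.single g 1 * charSum ψ K) =
      ψ (g⁻¹ * t * g) • (charSum χ H * MonoidAlgebra.single g 1 * charSum ψ K) :=
    calc _ = charSum χ H * (MonoidAlgebra.single t⁻¹ 1 * MonoidAlgebra.single g 1) *
          charSum ψ K := by
          rw [← mul_assoc, charSum_mul_single_one (H.inv_mem hH), inv_inv, smul_mul_assoc,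
            smul_mul_assoc]
      _ = _ := by
          rw [hcomm, ← mul_assoc, mul_assoc _ _ (charSum ψ K),
            single_one_mul_charSum (K.inv_mem hK), inv_inv, mul_smul_comm]
  rw [← sub_eq_zero, ← sub_smul] at h
  exact (smul_eq_zero_iff_right (sub_ne_zero.2 ht)).1 h

theorem charSum_mul_mul_charSum_eq_zero
    (h : ∀ g, ∃ t ∈ H, g⁻¹ * t * g ∈ K ∧ χ t ≠ ψ (g⁻¹ * t * g)) (x : k[G]) :
    charSum χ H * x * charSum ψ K = 0 :=
  (Submodule.mem_bot k).1 <| mul_mul_mem_of_forall_single (fun g => by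
    obtain ⟨t, hH, hK, ht⟩ := h g
    rw [charSum_mul_single_mul_charSum_eq_zero hH hK ht]
    exact zero_mem _) x

/-- The criterion of von Neumann for `χ` and `ψ` to have exactly one double coset of `H` and `K`,
that of `1`, in common. -/
theorem exists_charSum_mul_mul_charSum_eq_smul
    (h : ∀ g, (∃ p ∈ H, ∃ q ∈ K, p * q = g) ∨
      ∃ t ∈ H, g⁻¹ * t * g ∈ K ∧ χ t ≠ ψ (g⁻¹ * t * g)) (x : k[G]) :
    ∃ s : k, charSum χ H * x * charSum ψ K = s • (charSum χ H * charSum ψ K) := by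
  suffices hx : charSum χ H * x * charSum ψ K ∈
      Submodule.span k {charSum χ H * charSum ψ K} by
    obtain ⟨s, hs⟩ := Submodule.mem_span_singleton.1 hx
    exact ⟨s, hs.symm⟩
  refine mul_mul_mem_of_forall_single (fun g => ?_) x
  rcases h g with ⟨p, hp, q, hq, rfl⟩ | ⟨t, hH, hK, ht⟩
  · rw [← mul_one (1 : k), ← MonoidAlgebra.single_mul_single, ← mul_assoc, mul_assoc,
      charSum_mul_single_one hp, single_one_mul_charSum hq, smul_mul_smul_comm]
    exact Submodule.smul_mem _ _ (Submodule.mem_span_singleton_self _)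
  · rw [charSum_mul_single_mul_charSum_eq_zero hH hK ht]
    exact zero_mem _

end CharSum

theorem asAlgebraHom_charSum_map {G' E : Type*} [Group G'] [Fintype G'] [AddCommGroup E]
    [Module k E] {ρ : Representation k G' E} {χ : G' →* k} {φ : G →* G'}
    (hφ : Function.Injective φ) (H : Subgroup G) :
    ρ.asAlgebraHom (charSum χ (H.map φ)) =
      Representation.asAlgebraHom (ρ.comp φ) (charSum (χ.comp φ) H) := by
  classical
  simp only [charSum, map_sum, Representation.asAlgebraHom_single, MonoidHom.comp_apply]
  refine (Finset.sum_bij (fun g _ => φ g) (fun g hg => ?_) (fun _ _ _ _ h => hφ h) (fun g hg => ?_)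
    fun _ _ => rfl).symm
  · exact Finset.mem_filter.2
      ⟨Finset.mem_univ _, Subgroup.mem_map_of_mem φ (Finset.mem_filter.1 hg).2⟩
  · obtain ⟨h, hh, rfl⟩ := (Finset.mem_filter.1 hg).2
    exact ⟨h, Finset.mem_filter.2 ⟨Finset.mem_univ _, hh⟩, rfl⟩

end GroupAlgebra

/-! ### Young diagrams -/

/-- The number of boxes in the first `k` rows of a diagram, i.e. the partial sum
`μ₁ + ⋯ + μ_k` of the dominance order. -/
def cardFirstRows (mu : YoungDiagram) (k : ℕ) : ℕ :=
  (mu.cells.filter fun x => x.1 < k).card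

theorem cardFirstRows_succ (mu : YoungDiagram) (k : ℕ) :
    cardFirstRows mu (k + 1) = cardFirstRows mu k + mu.rowLen k := by
  rw [cardFirstRows, cardFirstRows, mu.rowLen_eq_card, YoungDiagram.row,
    ← Finset.card_union_of_disjoint]
  · congr 1
    ext x
    simp only [Finset.mem_filter, Finset.mem_union, Nat.lt_succ_iff_lt_or_eq, and_or_left]
  · exact Finset.disjoint_filter.2 fun x _ hlt heq => hlt.ne heq

theorem cardFirstRows_injective : Function.Injective cardFirstRows := by
  intro mu nu h
  have hrow (k : ℕ) : mu.rowLen k = nu.rowLen k := by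
    have hk := congrFun h (k + 1)
    rw [cardFirstRows_succ, cardFirstRows_succ, h] at hk
    exact Nat.add_left_cancel hk
  refine YoungDiagram.ext (Finset.ext fun x => ?_)
  rw [YoungDiagram.mem_cells, YoungDiagram.mem_cells]
  exact YoungDiagram.mem_iff_lt_rowLen.trans (hrow x.1 ▸ YoungDiagram.mem_iff_lt_rowLen.symm)

theorem card_filter_fst_lt_col (mu : YoungDiagram) (j k : ℕ) :
    ((mu.cells.filter fun x => x.1 < k).filter fun x => x.2 = j).card = min k (mu.colLen j) := by
  rw [← Finset.card_range (min k (mu.colLen j)),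
    ← Finset.card_image_of_injective (Finset.range _) (Prod.mk_left_injective j)]
  congr 1
  ext ⟨a, b⟩
  simp only [Finset.mem_filter, YoungDiagram.mem_cells, YoungDiagram.mem_iff_lt_colLen,
    Finset.mem_image, Finset.mem_range, lt_min_iff, Prod.mk.injEq]
  constructor
  · rintro ⟨⟨hcol, hk⟩, rfl⟩
    exact ⟨a, ⟨hk, hcol⟩, rfl, rfl⟩
  · rintro ⟨_, ⟨hk, hcol⟩, rfl, rfl⟩
    exact ⟨⟨hcol, hk⟩, rfl⟩

theorem cardFirstRows_eq_sum (mu : YoungDiagram) (k : ℕ) :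
    cardFirstRows mu k = ∑ j ∈ Finset.range (mu.rowLen 0), min k (mu.colLen j) := by
  simp only [← card_filter_fst_lt_col]
  refine Finset.card_eq_sum_card_fiberwise fun x hx => Finset.mem_coe.2 (Finset.mem_range.2 ?_)
  have hmem : x ∈ mu := (Finset.mem_filter.1 (Finset.mem_coe.1 hx)).1
  exact YoungDiagram.mem_iff_lt_rowLen.1 (mu.up_left_mem (Nat.zero_le _) le_rfl hmem)

section Fillings

variable {ι : Type*} [Fintype ι] {mu : YoungDiagram} {r c : ι → ℕ}

theorem lt_rowLen_of_card_fiber_eq_colLen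
    (hc : ∀ j, (Finset.univ.filter fun i => c i = j).card = mu.colLen j) (i : ι) :
    c i < mu.rowLen 0 := by
  have hpos : 0 < mu.colLen (c i) := by
    rw [← hc]
    exact Finset.card_pos.2 ⟨i, by simp⟩
  exact YoungDiagram.mem_iff_lt_rowLen.1 (YoungDiagram.mem_iff_lt_colLen.2 hpos)

theorem card_filter_lt_filter_eq_le_min (hrc : Function.Injective fun i => (r i, c i))
    (hc : ∀ j, (Finset.univ.filter fun i => c i = j).card = mu.colLen j) (j k : ℕ) :
    ((Finset.univ.filter fun i => r i < k).filter fun i => c i = j).card ≤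
      min k (mu.colLen j) := by
  refine le_min ?_ ?_
  · refine (Finset.card_le_card_of_injOn (t := Finset.range k) r (fun i hi => ?_)
      fun i hi i' hi' h => ?_).trans_eq (Finset.card_range k)
    · rw [Finset.mem_coe, Finset.mem_filter, Finset.mem_filter] at hi
      exact Finset.mem_coe.2 (Finset.mem_range.2 hi.1.2)
    · rw [Finset.mem_coe, Finset.mem_filter] at hi hi'
      exact hrc (Prod.ext h (hi.2.trans hi'.2.symm))
  · rw [← hc]
    exact Finset.card_le_card (Finset.filter_subset_filter _ (Finset.filter_subset _ _))

theorem card_filter_lt_eq_sum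
    (hc : ∀ j, (Finset.univ.filter fun i => c i = j).card = mu.colLen j) (k : ℕ) :
    (Finset.univ.filter fun i => r i < k).card = ∑ j ∈ Finset.range (mu.rowLen 0),
      ((Finset.univ.filter fun i => r i < k).filter fun i => c i = j).card :=
  Finset.card_eq_sum_card_fiberwise fun i _ =>
    Finset.mem_coe.2 (Finset.mem_range.2 (lt_rowLen_of_card_fiber_eq_colLen hc i))

theorem card_filter_lt_le_cardFirstRows (hrc : Function.Injective fun i => (r i, c i))
    (hc : ∀ j, (Finset.univ.filter fun i => c i = j).card = mu.colLen j) (k : ℕ) :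
    (Finset.univ.filter fun i => r i < k).card ≤ cardFirstRows mu k := by
  rw [card_filter_lt_eq_sum hc, cardFirstRows_eq_sum]
  exact Finset.sum_le_sum fun j _ => card_filter_lt_filter_eq_le_min hrc hc j k

/-- If `r` has as many values below each `k` as the rows of `mu`, then equality holds in each
column: the entries of column `j` occupy the first `μ'_j` rows. -/
theorem mk_mem_of_card_filter_lt_eq_cardFirstRows (hrc : Function.Injective fun i => (r i, c i))
    (hc : ∀ j, (Finset.univ.filter fun i => c i = j).card = mu.colLen j)
    (hr : ∀ k, (Finset.univ.filter fun i => r i < k).card = cardFirstRows mu k) (i : ι) :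
    (r i, c i) ∈ mu := by
  have hsum := hr (mu.colLen (c i))
  rw [card_filter_lt_eq_sum hc, cardFirstRows_eq_sum, Finset.sum_eq_sum_iff_of_le
    fun j _ => card_filter_lt_filter_eq_le_min hrc hc j _] at hsum
  have hcol := hsum (c i) (Finset.mem_range.2 (lt_rowLen_of_card_fiber_eq_colLen hc i))
  rw [min_self, ← hc] at hcol
  have hfilter := Finset.eq_of_subset_of_card_le
    (Finset.filter_subset_filter _ (Finset.filter_subset _ _)) hcol.ge
  have hi : i ∈ Finset.univ.filter fun i' => c i' = c i := by simp
  rw [← hfilter, hc, Finset.mem_filter, Finset.mem_filter] at hi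
  exact YoungDiagram.mem_iff_lt_colLen.2 hi.1.2

end Fillings

theorem card_cellsOfRowLens (w : List ℕ) : (YoungDiagram.cellsOfRowLens w).card = w.sum := by
  induction w with
  | nil => rfl
  | cons a w ih =>
    rw [YoungDiagram.cellsOfRowLens, Finset.card_union_of_disjoint, Finset.card_map, ih,
      Finset.card_product, Finset.card_singleton, Finset.card_range, one_mul, List.sum_cons]
    refine Finset.disjoint_left.2 fun x hx hx' => ?_
    obtain ⟨y, -, rfl⟩ := Finset.mem_map.1 hx'
    exact Nat.succ_ne_zero _ (Finset.mem_singleton.1 (Finset.mem_product.1 hx).1)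

/-- The Young diagram whose row lengths are the parts of a partition. -/
def diagramOfPartition {n : ℕ} (p : n.Partition) : YoungDiagram :=
  YoungDiagram.ofRowLens (p.parts.sort (· ≥ ·)) (Multiset.pairwise_sort _ _).sortedGE

theorem card_diagramOfPartition {n : ℕ} (p : n.Partition) : (diagramOfPartition p).card = n := by
  refine (card_cellsOfRowLens _).trans ?_
  rw [← Multiset.sum_coe, Multiset.sort_eq, p.parts_sum]

theorem coe_rowLens_diagramOfPartition {n : ℕ} (p : n.Partition) :
    ((diagramOfPartition p).rowLens : Multiset ℕ) = p.parts := by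
  rw [diagramOfPartition, YoungDiagram.rowLens_ofRowLens_eq_self fun x hx =>
    p.parts_pos ((Multiset.mem_sort _).1 hx), Multiset.sort_eq]

theorem diagramOfPartition_injective (n : ℕ) :
    Function.Injective (diagramOfPartition (n := n)) := fun p q h =>
  Nat.Partition.ext (by
    rw [← coe_rowLens_diagramOfPartition, ← coe_rowLens_diagramOfPartition, h])

/-- The diagram `mu` without its first row: the partition `λ` with `λ[n] = mu`. -/
def removeFirstRow (mu : YoungDiagram) : YoungDiagram where
  cells := (mu.cells.filter fun x => x.1 ≠ 0).image fun x => (x.1 - 1, x.2)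
  isLowerSet := by
    rintro ⟨i, j⟩ ⟨i', j'⟩ ⟨hi, hj⟩ hx
    simp only [Finset.coe_image, Finset.coe_filter, Set.mem_image, Set.mem_ofPred_eq, Prod.mk.injEq,
      Prod.exists, YoungDiagram.mem_cells] at hx ⊢
    simp only at hi hj
    obtain ⟨a, b, ⟨hab, ha⟩, rfl, rfl⟩ := hx
    exact ⟨i' + 1, j', ⟨mu.up_left_mem (by omega) hj hab, by omega⟩, rfl, rfl⟩

theorem mem_removeFirstRow {mu : YoungDiagram} {i j : ℕ} :
    (i, j) ∈ removeFirstRow mu ↔ (i + 1, j) ∈ mu := by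
  rw [← YoungDiagram.mem_cells, removeFirstRow]
  simp only [Finset.mem_image, Finset.mem_filter, Prod.mk.injEq, Prod.exists,
    YoungDiagram.mem_cells]
  constructor
  · rintro ⟨a, b, ⟨hab, ha⟩, rfl, rfl⟩
    rwa [Nat.sub_add_cancel (Nat.pos_of_ne_zero ha)]
  · exact fun h => ⟨i + 1, j, ⟨h, by omega⟩, rfl, rfl⟩

theorem card_removeFirstRow (mu : YoungDiagram) :
    (removeFirstRow mu).card + mu.rowLen 0 = mu.card := by
  have hcard : (removeFirstRow mu).card = (mu.cells.filter fun x => x.1 ≠ 0).card := by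
    refine Finset.card_image_of_injOn ?_
    rintro ⟨a, b⟩ hab ⟨a', b'⟩ hab' h
    have ha : a ≠ 0 := (Finset.mem_filter.1 hab).2
    have ha' : a' ≠ 0 := (Finset.mem_filter.1 hab').2
    obtain ⟨h1, rfl⟩ : a - 1 = a' - 1 ∧ b = b' := Prod.mk.inj h
    rw [Prod.mk.injEq]
    omega
  rw [hcard, mu.rowLen_eq_card, add_comm]
  exact Finset.card_filter_add_card_filter_not fun x : ℕ × ℕ => x.1 = 0

theorem rowLen_removeFirstRow_le (mu : YoungDiagram) :
    (removeFirstRow mu).rowLen 0 ≤ mu.rowLen 0 := by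
  refine le_of_forall_lt fun j hj => ?_
  rw [← YoungDiagram.mem_iff_lt_rowLen, mem_removeFirstRow] at hj
  exact YoungDiagram.mem_iff_lt_rowLen.1 (mu.up_left_mem (Nat.zero_le _) le_rfl hj)

theorem mk_zero_mem_paddedDiagram {lam : YoungDiagram} {n : ℕ}
    {h : lam.card + lam.rowLen 0 ≤ n} {j : ℕ} :
    (0, j) ∈ paddedDiagram lam n h ↔ j < n - lam.card := by
  rw [← YoungDiagram.mem_cells, paddedDiagram]
  simp

theorem mk_succ_mem_paddedDiagram {lam : YoungDiagram} {n : ℕ}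
    {h : lam.card + lam.rowLen 0 ≤ n} {i j : ℕ} :
    (i + 1, j) ∈ paddedDiagram lam n h ↔ (i, j) ∈ lam := by
  rw [← YoungDiagram.mem_cells, paddedDiagram]
  simp

theorem rowLen_paddedDiagram {lam : YoungDiagram} {n : ℕ} (h : lam.card + lam.rowLen 0 ≤ n) :
    (paddedDiagram lam n h).rowLen 0 = n - lam.card :=
  eq_of_forall_lt_iff fun j => by
    rw [← YoungDiagram.mem_iff_lt_rowLen, mk_zero_mem_paddedDiagram]

theorem paddedDiagram_removeFirstRow {mu : YoungDiagram} {n : ℕ} (hn : mu.card = n)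
    (h : (removeFirstRow mu).card + (removeFirstRow mu).rowLen 0 ≤ n) :
    paddedDiagram (removeFirstRow mu) n h = mu := by
  have hcard := card_removeFirstRow mu
  refine YoungDiagram.ext (Finset.ext ?_)
  rintro ⟨_ | i, j⟩
  · rw [YoungDiagram.mem_cells, YoungDiagram.mem_cells, mk_zero_mem_paddedDiagram,
      YoungDiagram.mem_iff_lt_rowLen]
    omega
  · rw [YoungDiagram.mem_cells, YoungDiagram.mem_cells, mk_succ_mem_paddedDiagram,
      mem_removeFirstRow]

/-! ### Young symmetrizers -/

section ColourStabilizer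

variable {α β γ : Type*}

/-- The permutations that preserve a colouring. For the rows and columns of a tableau these are
its row and column groups. -/
def colourStabilizer (f : α → β) : Subgroup (Equiv.Perm α) where
  carrier := {p | ∀ a, f (p a) = f a}
  one_mem' _ := rfl
  mul_mem' {_ q} hp hq a := (hp (q a)).trans (hq a)
  inv_mem' {p} hp a := (hp (p⁻¹ a)).symm.trans (congrArg f (p.apply_symm_apply a))

theorem swap_mem_colourStabilizer [DecidableEq α] {f : α → β} {a b : α} (h : f a = f b) :
    Equiv.swap a b ∈ colourStabilizer f :=
  fun _ => Equiv.apply_swap_eq_self h _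

theorem disjoint_colourStabilizer {f : α → β} {c : α → γ}
    (h : Function.Injective fun a => (f a, c a)) :
    Disjoint (colourStabilizer f) (colourStabilizer c) :=
  Subgroup.disjoint_def.2 fun hf hc => Equiv.ext fun a => h (Prod.ext (hf a) (hc a))

/-- The permutations that move only elements of the given finite set. -/
def permsOn (K : Finset α) : Subgroup (Equiv.Perm α) :=
  fixingSubgroup (Equiv.Perm α) (K : Set α)ᶜ

theorem mem_permsOn {K : Finset α} {p : Equiv.Perm α} :
    p ∈ permsOn K ↔ ∀ a ∉ K, p a = a := by
  simp [permsOn, mem_fixingSubgroup_iff]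

theorem permsOn_mono : Monotone (permsOn (α := α)) := fun _ _ h _ hp =>
  mem_permsOn.2 fun a ha => mem_permsOn.1 hp a fun haK => ha (h haK)

theorem permsOn_empty : permsOn (∅ : Finset α) = ⊥ :=
  (Subgroup.eq_bot_iff_forall _).2 fun _ hp =>
    Equiv.ext fun a => mem_permsOn.1 hp a (Finset.notMem_empty a)

theorem swap_mem_permsOn [DecidableEq α] {K : Finset α} {a b : α} (ha : a ∈ K) (hb : b ∈ K) :
    Equiv.swap a b ∈ permsOn K := mem_permsOn.2 fun _ hx =>
  Equiv.swap_apply_of_ne_of_ne (fun h => hx (h ▸ ha)) fun h => hx (h ▸ hb)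

theorem permsOn_le_colourStabilizer {K : Finset α} {f : α → β} {b : β} (h : ∀ a ∈ K, f a = b) :
    permsOn K ≤ colourStabilizer f := fun p hp a => by
  by_cases ha : a ∈ K
  · have hpa : p a ∈ K := by
      by_contra hpa
      exact hpa (by rwa [p.injective (mem_permsOn.1 hp _ hpa)])
    rw [h _ hpa, h _ ha]
  · rw [mem_permsOn.1 hp a ha]

theorem map_conj_permsOn (g : Equiv.Perm α) (K : Finset α) :
    (permsOn K).map (MulAut.conj g).toMonoidHom = permsOn (K.map g.toEmbedding) := by
  refine SubMulAction.fixingSubgroup_map_conj_eq ?_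
  rw [Set.smul_set_compl, Finset.coe_map]
  rfl

variable [Fintype α] [DecidableEq α]

/-- The sign of a permutation as a complex number. -/
def signChar : Equiv.Perm α →* ℂ :=
  (Int.castRingHom ℂ : ℤ →* ℂ).comp ((Units.coeHom ℤ).comp Equiv.Perm.sign)

theorem signChar_swap {a b : α} (h : a ≠ b) : signChar (Equiv.swap a b) = -1 := by
  simp [signChar, Equiv.Perm.sign_swap h]

theorem exists_mem_conj_mem_colourStabilizer_one_ne_signChar {H : Subgroup (Equiv.Perm α)}
    {c : α → γ} {g : Equiv.Perm α} {a b : α} (hab : a ≠ b) (hH : Equiv.swap a b ∈ H)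
    (hc : c (g⁻¹ a) = c (g⁻¹ b)) :
    ∃ t ∈ H, g⁻¹ * t * g ∈ colourStabilizer c ∧
      (1 : Equiv.Perm α →* ℂ) t ≠ signChar (g⁻¹ * t * g) := by
  have hconj : g⁻¹ * Equiv.swap a b * g = Equiv.swap (g⁻¹ a) (g⁻¹ b) := by
    rw [Equiv.mul_swap_eq_swap_mul, inv_mul_cancel_right]
  refine ⟨_, hH, hconj ▸ swap_mem_colourStabilizer hc, ?_⟩
  rw [hconj, signChar_swap (g⁻¹.injective.ne hab), MonoidHom.one_apply]
  norm_num

end ColourStabilizer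

section Tableaux

open scoped MonoidAlgebra

variable {n : ℕ} {mu lam : YoungDiagram}

/-- The row of an entry of a tableau. -/
def rowIndex (T : Fin n ≃ mu.cells) (i : Fin n) : ℕ := (T i).1.1

/-- The column of an entry of a tableau. -/
def colIndex (T : Fin n ≃ mu.cells) (i : Fin n) : ℕ := (T i).1.2

theorem rowIndex_colIndex_injective (T : Fin n ≃ mu.cells) :
    Function.Injective fun i => (rowIndex T i, colIndex T i) :=
  Subtype.val_injective.comp T.injective

theorem card_filter_tableau (T : Fin n ≃ mu.cells) (P : ℕ × ℕ → Prop) [DecidablePred P] :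
    (Finset.univ.filter fun i => P (T i).1).card = (mu.cells.filter P).card := by
  refine Finset.card_bij (fun i _ => (T i).1) (fun i hi => ?_) (fun i _ j _ h => ?_) fun x hx => ?_
  · exact Finset.mem_filter.2 ⟨(T i).2, (Finset.mem_filter.1 hi).2⟩
  · exact T.injective (Subtype.ext h)
  · obtain ⟨hmem, hP⟩ := Finset.mem_filter.1 hx
    exact ⟨T.symm ⟨x, hmem⟩, by simpa using hP, by simp⟩

theorem card_filter_colIndex_perm_eq (T : Fin n ≃ mu.cells) (g : Equiv.Perm (Fin n)) (j : ℕ) :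
    (Finset.univ.filter fun i => colIndex T (g i) = j).card = mu.colLen j := by
  rw [YoungDiagram.colLen_eq_card]
  exact card_filter_tableau (g.trans T) fun x => x.2 = j

theorem card_filter_rowIndex_lt (T : Fin n ≃ mu.cells) (k : ℕ) :
    (Finset.univ.filter fun i => rowIndex T i < k).card = cardFirstRows mu k :=
  card_filter_tableau T fun x => x.1 < k

theorem card_filter_rowIndex_eq_zero (T : Fin n ≃ mu.cells) :
    (Finset.univ.filter fun i => rowIndex T i = 0).card = mu.rowLen 0 := by
  rw [YoungDiagram.rowLen_eq_card]
  exact card_filter_tableau T fun x => x.1 = 0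

theorem youngSymmetrizer_eq (T : Fin n ≃ mu.cells) :
    youngSymmetrizer T =
      charSum 1 (colourStabilizer (rowIndex T)) *
        charSum signChar (colourStabilizer (colIndex T)) := by
  unfold youngSymmetrizer charSum
  congr!

theorem coeff_youngSymmetrizer_one (T : Fin n ≃ mu.cells) : (youngSymmetrizer T).coeff 1 = 1 := by
  rw [youngSymmetrizer_eq]
  exact coeff_charSum_mul_charSum_one (disjoint_colourStabilizer (rowIndex_colIndex_injective T))

theorem youngSymmetrizer_ne_zero (T : Fin n ≃ mu.cells) : youngSymmetrizer T ≠ 0 := fun h => by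
  have hcoeff := coeff_youngSymmetrizer_one T
  rw [h] at hcoeff
  exact zero_ne_one hcoeff

/-- Two entries of a row of `T` that lie in a column of the translate of `S` by `g` make the two
characters differ on a transposition. -/
theorem exists_conj_mem_or_injective (T : Fin n ≃ mu.cells) (S : Fin n ≃ lam.cells)
    (g : Equiv.Perm (Fin n)) :
    (∃ t ∈ colourStabilizer (rowIndex T), g⁻¹ * t * g ∈ colourStabilizer (colIndex S) ∧
      (1 : Equiv.Perm (Fin n) →* ℂ) t ≠ signChar (g⁻¹ * t * g)) ∨
      Function.Injective fun i => (rowIndex T i, colIndex S (g⁻¹ i)) := by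
  refine or_iff_not_imp_right.2 fun hinj => ?_
  obtain ⟨i, j, hij, hne⟩ := Function.not_injective_iff.1 hinj
  obtain ⟨hrow, hcol⟩ := Prod.mk.inj hij
  exact exists_mem_conj_mem_colourStabilizer_one_ne_signChar hne
    (swap_mem_colourStabilizer hrow) hcol

theorem youngSymmetrizer_mul_mul_eq_zero (T : Fin n ≃ mu.cells) (S : Fin n ≃ lam.cells) {k : ℕ}
    (h : cardFirstRows lam k < cardFirstRows mu k) (x : ℂ[Equiv.Perm (Fin n)]) :
    youngSymmetrizer T * x * youngSymmetrizer S = 0 := by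
  rw [youngSymmetrizer_eq, youngSymmetrizer_eq S, mul_assoc, mul_assoc, ← mul_assoc x,
    ← mul_assoc _ (x * _), ← mul_assoc]
  refine charSum_mul_mul_charSum_eq_zero (fun g => ?_) _
  refine (exists_conj_mem_or_injective T S g).resolve_right fun hinj => h.not_ge ?_
  rw [← card_filter_rowIndex_lt T]
  exact card_filter_lt_le_cardFirstRows hinj (card_filter_colIndex_perm_eq S g⁻¹) k

theorem exists_mul_eq_of_rowIndex_colIndex_injective (T : Fin n ≃ mu.cells)
    {g : Equiv.Perm (Fin n)} (h : Function.Injective fun i => (rowIndex T i, colIndex T (g⁻¹ i))) :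
    ∃ p ∈ colourStabilizer (rowIndex T), ∃ q ∈ colourStabilizer (colIndex T), p * q = g := by
  have hmem := mk_mem_of_card_filter_lt_eq_cardFirstRows h (card_filter_colIndex_perm_eq T g⁻¹)
    (card_filter_rowIndex_lt T)
  let e : Fin n → Fin n := fun i => T.symm ⟨(rowIndex T i, colIndex T (g⁻¹ i)), hmem i⟩
  have hrow (i : Fin n) : rowIndex T (e i) = rowIndex T i := by simp [e, rowIndex]
  have hcol (i : Fin n) : colIndex T (e i) = colIndex T (g⁻¹ i) := by simp [e, colIndex]
  have he : Function.Injective e := fun i j hij =>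
    h (Subtype.mk.inj (T.symm.injective hij))
  let p : Equiv.Perm (Fin n) := Equiv.ofBijective e (Finite.injective_iff_bijective.1 he)
  exact ⟨p⁻¹, inv_mem hrow, p * g,
    fun i => (hcol (g i)).trans (congrArg _ (g.symm_apply_apply i)), inv_mul_cancel_left p g⟩

theorem exists_youngSymmetrizer_mul_mul_eq_smul (T : Fin n ≃ mu.cells)
    (x : ℂ[Equiv.Perm (Fin n)]) :
    ∃ s : ℂ, youngSymmetrizer T * x * youngSymmetrizer T = s • youngSymmetrizer T := by
  rw [youngSymmetrizer_eq, mul_assoc, mul_assoc, ← mul_assoc x, ← mul_assoc _ (x * _), ← mul_assoc]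
  refine exists_charSum_mul_mul_charSum_eq_smul (fun g => ?_) _
  exact ((exists_conj_mem_or_injective T T g).imp_right
    (exists_mul_eq_of_rowIndex_colIndex_injective T)).symm

theorem charSum_permsOn_mul_mul_youngSymmetrizer_eq_zero (T : Fin n ≃ mu.cells)
    {K : Finset (Fin n)} (h : mu.rowLen 0 < K.card) (x : ℂ[Equiv.Perm (Fin n)]) :
    charSum 1 (permsOn K) * x * youngSymmetrizer T = 0 := by
  rw [youngSymmetrizer_eq, ← mul_assoc, mul_assoc _ x]
  refine charSum_mul_mul_charSum_eq_zero (fun g => ?_) _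
  obtain ⟨i, hi, j, hj, hij, hcol⟩ := Finset.exists_ne_map_eq_of_card_lt_of_maps_to
    (t := Finset.range (mu.rowLen 0)) (f := fun i => colIndex T (g⁻¹ i))
    (by rwa [Finset.card_range]) fun i _ => Finset.mem_coe.2 <| Finset.mem_range.2 <|
      lt_rowLen_of_card_fiber_eq_colLen (card_filter_colIndex_perm_eq T g⁻¹) i
  exact exists_mem_conj_mem_colourStabilizer_one_ne_signChar hij (swap_mem_permsOn hi hj) hcol

theorem exists_charSum_permsOn_mul_youngSymmetrizer_ne_zero (T : Fin n ≃ mu.cells) {k : ℕ}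
    (h : k ≤ mu.rowLen 0) :
    ∃ K : Finset (Fin n), K.card = k ∧ charSum 1 (permsOn K) * youngSymmetrizer T ≠ 0 := by
  rw [← card_filter_rowIndex_eq_zero T] at h
  obtain ⟨K, hK, hk⟩ := Finset.exists_subset_card_eq h
  refine ⟨K, hk, ?_⟩
  rw [youngSymmetrizer_eq, ← mul_assoc, charSum_mul_charSum_of_le
    (permsOn_le_colourStabilizer fun i hi => (Finset.mem_filter.1 (hK hi)).2), smul_mul_assoc,
    ← youngSymmetrizer_eq]
  exact smul_ne_zero Nat.card_pos.ne' (youngSymmetrizer_ne_zero T)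

end Tableaux

/-! ### Constituents -/

section Constituents

open scoped MonoidAlgebra

variable {n : ℕ} {E : Type*} [AddCommGroup E] [Module ℂ E]
  {ρ : Representation ℂ (Equiv.Perm (Fin n)) E}

theorem exists_diagram_conjClasses (n : ℕ) :
    ∃ diag : ConjClasses (Equiv.Perm (Fin n)) → YoungDiagram,
      Function.Injective diag ∧ ∀ C, (diag C).card = n := by
  classical
  have hpart (σ τ : Equiv.Perm (Fin n)) : IsConj σ τ ↔ σ.partition = τ.partition :=
    Equiv.Perm.partition_eq_of_isConj
  refine ⟨fun C => diagramOfPartition C.out.partition, fun C D h => ?_, fun C =>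
    (card_diagramOfPartition _).trans (Fintype.card_fin n)⟩
  rw [← Quotient.out_eq C, ← Quotient.out_eq D]
  exact Quotient.sound ((hpart _ _).2 (diagramOfPartition_injective _ h))

/-- The number of partitions of `n` is the dimension of the centre of `ℂ[S_n]`, so that the central
elements obtained from one tableau of each shape span it. -/
theorem one_mem_span_conjSum_youngSymmetrizer
    {diag : ConjClasses (Equiv.Perm (Fin n)) → YoungDiagram} (hdiag : Function.Injective diag)
    (T : ∀ C, Fin n ≃ (diag C).cells) :
    1 ∈ Submodule.span ℂ (Set.range fun C => conjSum (youngSymmetrizer (T C))) := by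
  have hzero {C D} {k : ℕ} (h : cardFirstRows (diag D) k < cardFirstRows (diag C) k) :
      conjSum (youngSymmetrizer (T C)) * conjSum (youngSymmetrizer (T D)) = 0 :=
    conjSum_mul_conjSum_eq_zero (youngSymmetrizer_mul_mul_eq_zero (T C) (T D) h)
  refine one_mem_span_range_of_mem_center (fun C => conjSum_mem_center _)
    (linearIndependent_of_mul_eq_zero (fun C D hCD => ?_) fun C =>
      mul_self_ne_zero_of_mem_center (conjSum_mem_center _) (conjSum_ne_zero ?_))
  · obtain ⟨k, hk⟩ := Function.ne_iff.1 (cardFirstRows_injective.ne (hdiag.ne hCD))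
    rcases lt_or_gt_of_ne hk with h | h
    · exact (Subalgebra.mem_center_iff.1 (conjSum_mem_center _) _).trans (hzero h)
    · exact hzero h
  · rw [coeff_youngSymmetrizer_one]
    exact one_ne_zero

theorem exists_youngSymmetrizer_apply_ne_zero {u : E} (hu : u ≠ 0) :
    ∃ (mu : YoungDiagram) (T : Fin n ≃ mu.cells) (g : Equiv.Perm (Fin n)),
      ρ.asAlgebraHom (youngSymmetrizer T) (ρ g u) ≠ 0 := by
  obtain ⟨diag, hdiag, hcard⟩ := exists_diagram_conjClasses n
  let T (C) : Fin n ≃ (diag C).cells := (Finset.equivFinOfCardEq (hcard C)).symm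
  by_contra! h
  have hle : Submodule.span ℂ (Set.range fun C => conjSum (youngSymmetrizer (T C))) ≤
      LinearMap.ker ((LinearMap.applyₗ u).comp ρ.asAlgebraHom.toLinearMap) := by
    refine Submodule.span_le.2 (Set.range_subset_iff.2 fun C => ?_)
    by_contra hC
    obtain ⟨g, hg⟩ := exists_of_asAlgebraHom_conjSum_ne_zero (ρ := ρ) (u := u) hC
    exact hg (h _ (T C) g)
  have h1 : ρ.asAlgebraHom 1 u = 0 := hle (one_mem_span_conjSum_youngSymmetrizer hdiag T)
  rw [map_one] at h1
  exact hu h1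

/-- The vectors that are killed by the symmetrizers of all sets of `k` points: the sum of the
irreducible constituents `V_mu` whose first row has fewer than `k` boxes. -/
noncomputable def shortRowPart (ρ : Representation ℂ (Equiv.Perm (Fin n)) E) (k : ℕ) :
    Submodule ℂ E :=
  ⨅ (K : Finset (Fin n)) (_ : K.card = k), LinearMap.ker (ρ.asAlgebraHom (charSum 1 (permsOn K)))

theorem mem_shortRowPart {k : ℕ} {v : E} : v ∈ shortRowPart ρ k ↔
    ∀ K : Finset (Fin n), K.card = k → ρ.asAlgebraHom (charSum 1 (permsOn K)) v = 0 := by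
  simp only [shortRowPart, Submodule.mem_iInf, LinearMap.mem_ker]

theorem rep_mem_shortRowPart {k : ℕ} {v : E} (h : v ∈ shortRowPart ρ k)
    (g : Equiv.Perm (Fin n)) : ρ g v ∈ shortRowPart ρ k := mem_shortRowPart.2 fun K hK => by
  have hcomm : charSum 1 (permsOn K) * MonoidAlgebra.single g (1 : ℂ) =
      MonoidAlgebra.single g 1 * charSum 1 (permsOn (K.map g⁻¹.toEmbedding)) := by
    rw [single_mul_charSum_eq_charSum_map_conj_mul_single, map_conj_permsOn, Finset.map_map]
    congr 3
    ext i
    simp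
  rw [← ρ.asAlgebraHom_single_one, ← Module.End.mul_apply, ← map_mul, hcomm, map_mul,
    Module.End.mul_apply, mem_shortRowPart.1 h _ ((Finset.card_map _).trans hK), map_zero]

theorem asAlgebraHom_mem_shortRowPart {k : ℕ} {v : E} (h : v ∈ shortRowPart ρ k)
    (x : ℂ[Equiv.Perm (Fin n)]) : ρ.asAlgebraHom x v ∈ shortRowPart ρ k := by
  rw [Representation.asAlgebraHom_def, MonoidAlgebra.lift_apply, Finsupp.sum, LinearMap.sum_apply]
  exact Submodule.sum_mem _ fun g _ => Submodule.smul_mem _ _ (rep_mem_shortRowPart h g)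

theorem asAlgebraHom_charSum_permsOn_eq_zero_of_subset {K L : Finset (Fin n)} (hLK : L ⊆ K) {v : E}
    (h : ρ.asAlgebraHom (charSum 1 (permsOn L)) v = 0) :
    ρ.asAlgebraHom (charSum 1 (permsOn K)) v = 0 := by
  have hKL : ρ.asAlgebraHom (charSum 1 (permsOn K) * charSum 1 (permsOn L)) v = 0 := by
    rw [map_mul, Module.End.mul_apply, h, map_zero]
  rw [charSum_mul_charSum_of_ge (permsOn_mono hLK), ← Nat.cast_smul_eq_nsmul ℂ, map_smul,
    LinearMap.smul_apply] at hKL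
  exact (smul_eq_zero_iff_right (Nat.cast_ne_zero.2 Nat.card_pos.ne')).1 hKL

theorem shortRowPart_zero : shortRowPart ρ 0 = ⊥ := by
  refine (Submodule.eq_bot_iff _).2 fun v hv => ?_
  have h := mem_shortRowPart.1 hv ∅ rfl
  rwa [permsOn_empty, charSum_bot, map_one] at h

variable {mu : YoungDiagram}

theorem coe_youngRep_asAlgebraHom_apply (T : Fin n ≃ mu.cells) (x : ℂ[Equiv.Perm (Fin n)])
    (y : youngIdeal T) : ((youngRep T).asAlgebraHom x y : ℂ[Equiv.Perm (Fin n)]) = x * y := by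
  induction x using MonoidAlgebra.induction_linear with
  | zero => simp
  | add x x' hx hx' => simp [hx, hx', add_mul]
  | single g a =>
    rw [Representation.asAlgebraHom_single, ← mul_one a, ← MonoidAlgebra.smul_single', mul_one,
      smul_mul_assoc]
    rfl

/-- The map of representations `ℂ[S_n] c_T → E`, `x ↦ x u`. -/
noncomputable def orbitMap (T : Fin n ≃ mu.cells) (ρ : Representation ℂ (Equiv.Perm (Fin n)) E)
    (u : E) : (youngRep T).IntertwiningMap ρ where
  toLinearMap := ((LinearMap.applyₗ u).comp ρ.asAlgebraHom.toLinearMap).comp (youngIdeal T).subtype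
  isIntertwining' g := by
    have h (x : ℂ[Equiv.Perm (Fin n)]) :
        ρ.asAlgebraHom (MonoidAlgebra.single g 1 * x) u = ρ g (ρ.asAlgebraHom x u) := by
      rw [map_mul, Module.End.mul_apply, Representation.asAlgebraHom_single_one]
    exact LinearMap.ext fun y => h y.1

theorem orbitMap_injective (T : Fin n ≃ mu.cells) {u : E}
    (hu : ρ.asAlgebraHom (youngSymmetrizer T) u ≠ 0) : Function.Injective (orbitMap T ρ u) := by
  refine (injective_iff_map_eq_zero (orbitMap T ρ u).toLinearMap).2 ?_
  rintro ⟨_, x, rfl⟩ hx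
  exact Subtype.ext
    (eq_zero_of_asAlgebraHom_eq_zero (exists_youngSymmetrizer_mul_mul_eq_smul T) hu hx)

theorem exists_isConstituent_of_shortRowPart_ne_bot {k : ℕ} (h : shortRowPart ρ k ≠ ⊥) :
    ∃ mu : YoungDiagram, mu.rowLen 0 < k ∧ IsConstituent mu ρ := by
  obtain ⟨v, hv, hv0⟩ := Submodule.exists_mem_ne_zero_of_ne_bot h
  obtain ⟨mu, T, g, hT⟩ := exists_youngSymmetrizer_apply_ne_zero (ρ := ρ) hv0
  have hinj := orbitMap_injective T hT
  refine ⟨mu, ?_, T, _, hinj⟩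
  by_contra! hle
  obtain ⟨K, hK, hne⟩ := exists_charSum_permsOn_mul_youngSymmetrizer_ne_zero T hle
  have hzero : orbitMap T ρ (ρ g v) ⟨_, ⟨charSum 1 (permsOn K), rfl⟩⟩ = 0 := by
    refine (LinearMap.congr_fun (map_mul ρ.asAlgebraHom _ _) _).trans ?_
    exact mem_shortRowPart.1
      (asAlgebraHom_mem_shortRowPart (rep_mem_shortRowPart hv g) (youngSymmetrizer T)) K hK
  exact hne (congrArg Subtype.val
    ((injective_iff_map_eq_zero (orbitMap T ρ (ρ g v)).toLinearMap).1 hinj _ hzero))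

theorem shortRowPart_ne_bot_of_isConstituent {k : ℕ} (h : mu.rowLen 0 < k)
    (hc : IsConstituent mu ρ) : shortRowPart ρ k ≠ ⊥ := by
  obtain ⟨T, f, hf⟩ := hc
  let y : youngIdeal T := ⟨youngSymmetrizer T, 1, one_mul _⟩
  refine Submodule.ne_bot_iff _ |>.2 ⟨f y, mem_shortRowPart.2 fun K hK => ?_, fun h0 => ?_⟩
  · have hzero : (youngRep T).asAlgebraHom (charSum 1 (permsOn K)) y = 0 := by
      have hmul := charSum_permsOn_mul_mul_youngSymmetrizer_eq_zero T (hK ▸ h) 1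
      rw [mul_one] at hmul
      exact Subtype.ext ((coe_youngRep_asAlgebraHom_apply T _ y).trans hmul)
    rw [asAlgebraHom_intertwiningMap_apply, hzero, map_zero]
  · exact youngSymmetrizer_ne_zero T (congrArg Subtype.val
      ((injective_iff_map_eq_zero f.toLinearMap).1 hf _ h0))

theorem IsConstituent.card_eq (h : IsConstituent mu ρ) : mu.card = n := by
  obtain ⟨T, -⟩ := h
  rw [← Fintype.card_fin n, Fintype.card_congr T, Fintype.card_coe]

end Constituents

/-! ### The weight of the shift -/

theorem map_permSucc_permsOn {n : ℕ} (K : Finset (Fin n)) :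
    (permsOn K).map permSucc = permsOn (K.map (Fin.succEmb n)) := by
  have hmem (i : Fin n) : i.succ ∈ K.map (Fin.succEmb n) ↔ i ∈ K :=
    Finset.mem_map' (Fin.succEmb n)
  have h0 : (0 : Fin (n + 1)) ∉ K.map (Fin.succEmb n) := by simp
  ext τ
  rw [Subgroup.mem_map, mem_permsOn]
  constructor
  · rintro ⟨σ, hσ, rfl⟩ i hi
    induction i using Fin.cases with
    | zero => exact permSucc_zero σ
    | succ i => rw [permSucc_succ, mem_permsOn.1 hσ i fun h => hi ((hmem i).2 h)]
  · intro hτ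
    obtain ⟨σ, rfl⟩ := exists_permSucc_eq (hτ 0 h0)
    refine ⟨σ, mem_permsOn.2 fun i hi => Fin.succ_injective n ?_, rfl⟩
    rw [← permSucc_succ]
    exact hτ i.succ fun h => hi ((hmem i).1 h)

theorem exists_card_eq_map_succEmb_subset {n k : ℕ} {K : Finset (Fin (n + 1))}
    (h : k + 1 ≤ K.card) : ∃ L : Finset (Fin n), L.card = k ∧ L.map (Fin.succEmb n) ⊆ K := by
  let P : Finset (Fin n) := K.preimage Fin.succ (Fin.succ_injective n).injOn
  have hKP : K ⊆ insert 0 (P.map (Fin.succEmb n)) := fun i hi => by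
    induction i using Fin.cases with
    | zero => exact Finset.mem_insert_self _ _
    | succ i =>
      exact Finset.mem_insert_of_mem
        (Finset.mem_map_of_mem (Fin.succEmb n) (Finset.mem_preimage.2 hi))
  have hcard := (Finset.card_le_card hKP).trans (Finset.card_insert_le _ _)
  rw [Finset.card_map] at hcard
  obtain ⟨L, hLP, hL⟩ := Finset.exists_subset_card_eq (Nat.le_of_succ_le_succ (h.trans hcard))
  refine ⟨L, hL, Finset.map_subset_iff_subset_preimage.2 hLP⟩

namespace FIModule

variable {V : FIModule.{u}}

theorem hasWeightLE_iff_shortRowPart_eq_bot {M : ℕ} :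
    V.HasWeightLE M ↔ ∀ n, shortRowPart (V.rep n) (n - M) = ⊥ := by
  constructor
  · intro H n
    by_contra hne
    obtain ⟨mu, hmu, hc⟩ := exists_isConstituent_of_shortRowPart_ne_bot hne
    have hcard := card_removeFirstRow mu
    have hrow := rowLen_removeFirstRow_le mu
    have hn := hc.card_eq
    have hpad : (removeFirstRow mu).card + (removeFirstRow mu).rowLen 0 ≤ n := by omega
    have hM := H n (removeFirstRow mu) hpad (by rwa [paddedDiagram_removeFirstRow hn hpad])
    omega
  · intro H n lam h hc
    by_contra! hlt
    refine shortRowPart_ne_bot_of_isConstituent ?_ hc (H n)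
    rw [rowLen_paddedDiagram]
    omega

theorem mem_shortRowPart_shift {n k : ℕ} {v : V.at' (n + 1)} :
    v ∈ shortRowPart (V.shift.rep n) k ↔ ∀ K : Finset (Fin n), K.card = k →
      (V.rep (n + 1)).asAlgebraHom (charSum 1 (permsOn (K.map (Fin.succEmb n)))) v = 0 := by
  have hrep : V.shift.rep n = MonoidHom.comp (V.rep (n + 1)) permSucc := MonoidHom.ext V.shift_rep
  refine (mem_shortRowPart (ρ := V.shift.rep n)).trans (forall₂_congr fun K _ => ?_)
  rw [← map_permSucc_permsOn, asAlgebraHom_charSum_map (permSucc_injective n),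
    MonoidHom.one_comp]
  exact iff_of_eq <| congrArg
    (fun ρ : Representation ℂ _ (V.at' (n + 1)) => ρ.asAlgebraHom (charSum 1 (permsOn K)) v = 0)
    hrep

theorem HasWeightLE.of_shift {M : ℕ} (h : V.shift.HasWeightLE M) : V.HasWeightLE (M + 1) := by
  rw [hasWeightLE_iff_shortRowPart_eq_bot] at h ⊢
  rintro (_ | n)
  · rw [Nat.zero_sub, shortRowPart_zero]
  · refine eq_bot_mono (fun v hv => mem_shortRowPart_shift.2 fun K hK => ?_) (h n)
    exact mem_shortRowPart.1 hv _ (by rw [Finset.card_map, hK, Nat.add_sub_add_right])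

theorem HasWeightLE.shift {M : ℕ} (h : V.HasWeightLE M) : V.shift.HasWeightLE M := by
  rw [hasWeightLE_iff_shortRowPart_eq_bot] at h ⊢
  intro n
  rcases lt_or_ge n M with hn | hn
  · rw [Nat.sub_eq_zero_of_le hn.le, shortRowPart_zero]
  · refine eq_bot_mono (fun v hv => mem_shortRowPart.2 fun K hK => ?_) (h (n + 1))
    obtain ⟨L, hL, hLK⟩ := exists_card_eq_map_succEmb_subset (k := n - M) (K := K) (by omega)
    exact asAlgebraHom_charSum_permsOn_eq_zero_of_subset hLK (mem_shortRowPart_shift.1 hv L hL)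

end FIModule

theorem mainTheorem4 (V : FIModule.{u}) :
    -- degree of generation, for finitely generated modules
    (∀ d : ℕ, V.FinitelyGenerated → V.GeneratedInDegreeLE d →
      V.shift.FinitelyGeneratedInDegreeLE d) ∧
    (∀ d : ℕ, Module.Finite ℂ (V.at' 0) → V.shift.FinitelyGeneratedInDegreeLE d →
      V.FinitelyGeneratedInDegreeLE (d + 1)) ∧
    -- degree of generation, for arbitrary modules
    (∀ d : ℕ, V.GeneratedInDegreeLE d → V.shift.GeneratedInDegreeLE d) ∧
    (∀ d : ℕ, V.shift.GeneratedInDegreeLE d → V.GeneratedInDegreeLE (d + 1)) ∧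
    -- weight
    (∀ M : ℕ, V.shift.HasWeightLE M → V.HasWeightLE (M + 1)) ∧
    (∀ M : ℕ, V.HasWeightLE M → V.shift.HasWeightLE M) ∧
    -- stability degree
    (∀ N : ℕ, V.shift.HasStabilityDegreeLE N → V.HasStabilityDegreeLE (N + 1)) ∧
    (∀ N : ℕ, V.HasStabilityDegreeLE N → V.shift.HasStabilityDegreeLE N) := by
  exact ⟨fun d h hd => (h.finitelyGeneratedInDegreeLE hd).shift, fun d _ h => h.of_shift,
    fun d h => h.shift, fun d h => h.of_shift, fun M h => h.of_shift, fun M h => h.shift,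
    fun N h => h.of_shift, fun N h => h.shift⟩
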